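/- Let $\mathbb F_q$ be the finite field with $q$ elements, $q$ a prime power. For $\alpha=(\alpha_1,\dots,\alpha_n)\in\mathbb F_q^n$ and an integer $k\ge 0$, let $$\mathrm{RS}(\alpha;k)=\{(f(\alpha_1),\dots,f(\alpha_n)) : f\in\mathbb F_q[X],\ \deg f<k\}\subseteq\mathbb F_q^n;$$ the evaluation points are allowed to repeat. When $\alpha_1,\dots,\alpha_n$ are sampled independently and uniformly from $\mathbb F_q$, this is called a random Reed--Solomon code of dimension $k$. For $\rho\in[0,1]$ and an integer $L\ge 1$, a code $C\subseteq\mathbb F_q^n$ is average-weight $(\rho,L)$-list-decodable if there are no $X\subseteq C$ with $|X|>L$ and $z\in\mathbb F_q^n$ such that $\frac1{|X|}\sum_{x\in X}\mathrm{wt}(x-z)\le\rho n$, where $\mathrm{wt}$ denotes the Hamming weight. **Corollary (list-decodability of random RS codes).** Let $\rho\in[0,1]$, let $L\ge 1$ and $n$ be natural numbers, let $\eta\in\mathbb R$, and let $\varepsilon>0$ satisfy $\varepsilon n\ge 2(L+1)(L+2)$. Let $k=Rn$ be a nonnegative integer, where $$R\le 1-\rho\left(1+\frac1L\right)-\varepsilon,$$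 and let $q$ be a prime power satisfying $$q\ \ge\ 2^{2(L+1)\cdot\frac{L+1+\eta}{\varepsilon}}\cdot\frac{k\cdot(4(L+1))^{4(L+1)}}{\varepsilon}.$$ Let $C\subseteq\mathbb F_q^n$ be a random Reed--Solomon code of dimension $k$. Then $C$ is average-weight $(\rho,L)$-list-decodable with probability at least $1-2^{-\eta n}$. -/

import Mathlib

open MeasureTheory ProbabilityTheory

/-- The Reed-Solomon code with (possibly repeating) evaluation points `α 0, …, α (n-1)` and
dimension parameter `k`: evaluation vectors of the polynomials of degree less than `k`. -/
def rsCode {F : Type*} [Field F] {n : ℕ} (α : Fin n → F) (k : ℕ) : Set (Fin n → F) :=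
  {c | ∃ f : Polynomial F, f.degree < (k : WithBot ℕ) ∧ c = fun i => f.eval (α i)}

/-- A set `X` of words is average-weight `ρ`-clustered if for some centre `z` the average Hamming
weight of `x - z` over `x ∈ X` is at most `ρ n`. -/
def IsAvgClustered {F : Type*} [Field F] [DecidableEq F] {n : ℕ} (ρ : ℝ)
    (X : Finset (Fin n → F)) : Prop :=
  ∃ z : Fin n → F, (∑ x ∈ X, (hammingNorm (x - z) : ℝ)) / (X.card : ℝ) ≤ ρ * n

/-- A code is average-weight `(ρ, L)`-list-decodable if it contains no average-weight
`ρ`-clustered set of size larger than `L`. -/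
def IsAvgListDecodable {F : Type*} [Field F] [DecidableEq F] {n : ℕ} (C : Set (Fin n → F))
    (ρ : ℝ) (L : ℕ) : Prop :=
  ¬ ∃ X : Finset (Fin n → F), (X : Set (Fin n → F)) ⊆ C ∧ IsAvgClustered ρ X ∧ L < X.card

/-- The joint law of `n` evaluation points sampled independently and uniformly from the finite
set `F`: the `n`-fold product of the uniform distribution on `F`. -/
noncomputable def iidUniform (F : Type*) [MeasurableSpace F] (n : ℕ) : Measure (Fin n → F) :=
  Measure.pi (fun _ : Fin n => (uniformOn (Set.univ : Set F) : Measure F))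

/-! If decoding fails, some L+1 distinct polynomials f_j of degree < k and a centre z have agreement
sets S i = {j : f_j(α_i) = z_i} with ∑ (|S i| - 1) ≥ (k + εn)L. There are at most 2^((L+1)n)
profiles S, so by a union bound it suffices to fix S and count the α admitting distinct f_j whose
values at α_i agree on S i (`ncard_agreement_profile_le`).

Combinatorics: pass to a minimal index set J still carrying this much agreement, and normalise f to
vanish at some c ∈ J and outside J. Minimality forces ∑ dim D_i V ≥ (k + δ) dim V for every
F(X)-space V of vectors vanishing there, where D_i takes differences on S i ∩ J
(`mul_finrank_le_sum_finrank_diffOn`).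

Algebra: let V be the F(X)-span of the solutions. Vectors of degree < k in V have F-dimension at
most k dim V, and a generic α_i makes the i-th constraint cut this dimension by at least dim D_i V.
A nonzero V therefore forces at least δ deficient constraints (`le_card_deficient`), each confined
to at most kL values of α_i (`card_rank_deficient_le`).

Probability: V itself depends on α, so these events cannot be multiplied directly. Take a maximal
set A of deficient constraints whose removal leaves the span V unchanged. Then V is determined by
the coordinates outside A, and exposing A in order costs (kL/q)^|A|. If A is too small, removing one
more deficient constraint enlarges the span, and one recurses on its rank, which is at most L
(`ncard_solSpace_rank_le`). -/

open Polynomial Module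

/-! ### Linear algebra: rank-nullity, minors, difference maps. -/

/-- Rank-nullity for the restriction of a linear map to a finite-dimensional subspace. -/
theorem finrank_map_add_finrank_inf_ker {E V V' : Type*} [Field E] [AddCommGroup V] [Module E V]
    [AddCommGroup V'] [Module E V'] (f : V →ₗ[E] V') (W : Submodule E V) [FiniteDimensional E W] :
    finrank E (W.map f) + finrank E (W ⊓ LinearMap.ker f : Submodule E V) = finrank E W := by
  have h := (f.domRestrict W).finrank_range_add_finrank_ker
  rw [LinearMap.range_domRestrict] at h
  rw [← h]
  congr 1
  have h2 : (W ⊓ LinearMap.ker f : Submodule E V)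
      = (LinearMap.ker (f.domRestrict W)).map W.subtype := by
    ext x
    simp only [Submodule.mem_inf, LinearMap.mem_ker, Submodule.mem_map]
    constructor
    · rintro ⟨h1, h2⟩
      exact ⟨⟨x, h1⟩, by simpa using h2, rfl⟩
    · rintro ⟨y, hy, rfl⟩
      exact ⟨y.2, by simpa using hy⟩
  rw [h2, Submodule.finrank_map_subtype_eq]

/-- Row rank equals column rank, so a basis of the column space can be chosen among the columns; it
has r members. -/
theorem exists_det_ne_zero_of_linearIndependent {E κ : Type*} [Field E] [Fintype κ] {r : ℕ}
    (v : Fin r → κ → E) (hv : LinearIndependent E v) :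
    ∃ c : Fin r → κ, (Matrix.of fun i j => v i (c j)).det ≠ 0 := by
  classical
  set A : Matrix (Fin r) κ E := Matrix.of v with hA
  have hr : A.rank = r := by
    have := LinearIndependent.rank_matrix (M := A) hv
    simpa using this
  rw [Matrix.rank_eq_finrank_span_cols] at hr
  obtain ⟨κ', a, ha, hspan, hli⟩ := exists_linearIndependent' E A.col
  have : Finite κ' := Finite.of_injective a ha
  have := Fintype.ofFinite κ'
  have hcard : Fintype.card κ' = r := by
    rw [← hr, ← hspan, finrank_span_eq_card hli]
  let e : Fin r ≃ κ' := (Fintype.equivFinOfCardEq hcard).symm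
  refine ⟨fun j => a (e j), ?_⟩
  have hli' := hli.comp e e.injective
  set B : Matrix (Fin r) (Fin r) E := Matrix.of fun i j => v i (a (e j)) with hB
  have : IsUnit B := by
    rw [← Matrix.linearIndependent_cols_iff_isUnit]
    exact hli'
  exact ((Matrix.isUnit_iff_isUnit_det _).1 this).ne_zero

/-- The vector of all differences `v j - v j'` with `j, j' ∈ S`; it vanishes iff `v` is constant
on `S`. -/
def diffOn {ι : Type*} [DecidableEq ι] (E : Type*) [CommRing E] (S : Finset ι) :
    (ι → E) →ₗ[E] (ι × ι → E) where
  toFun v p := if p.1 ∈ S ∧ p.2 ∈ S then v p.1 - v p.2 else 0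
  map_add' v w := by
    ext p
    simp only [Pi.add_apply]
    split_ifs <;> ring
  map_smul' c v := by
    ext p
    simp only [Pi.smul_apply, smul_eq_mul, RingHom.id_apply]
    split_ifs <;> ring

theorem diffOn_apply {ι : Type*} [DecidableEq ι] {E : Type*} [CommRing E] (S : Finset ι)
    (v : ι → E) (p : ι × ι) :
    diffOn E S v p = if p.1 ∈ S ∧ p.2 ∈ S then v p.1 - v p.2 else 0 := rfl

theorem diffOn_eq_zero_iff {ι : Type*} [DecidableEq ι] {E : Type*} [CommRing E] (S : Finset ι)
    (v : ι → E) : diffOn E S v = 0 ↔ ∀ j ∈ S, ∀ j' ∈ S, v j = v j' := by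
  constructor
  · intro h j hj j' hj'
    have := congrFun h (j, j')
    simpa [diffOn_apply, hj, hj', sub_eq_zero] using this
  · intro h
    ext p
    rw [diffOn_apply]
    split_ifs with hp
    · simp [h _ hp.1 _ hp.2]
    · rfl

theorem diffOn_map {ι : Type*} [DecidableEq ι] {E E' : Type*} [CommRing E] [CommRing E']
    (φ : E →+* E') (S : Finset ι) (v : ι → E) (p : ι × ι) :
    diffOn E' S (fun j => φ (v j)) p = φ (diffOn E S v p) := by
  rw [diffOn_apply, diffOn_apply]
  split_ifs <;> simp

/-! ### Polynomial vectors, their F(X)-spans, and specialisation at a point. -/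

section PolyVectors

variable {F ι : Type*} [Field F]

/-- Coordinatewise inclusion of polynomial vectors into rational function vectors. -/
noncomputable def toRat (f : ι → F[X]) : ι → RatFunc F := fun j => algebraMap F[X] (RatFunc F) (f j)

/-- The subspace of rational function vectors spanned by a space of polynomial vectors. -/
noncomputable def ratSpan (Y : Submodule F (ι → F[X])) : Submodule (RatFunc F) (ι → RatFunc F) :=
  Submodule.span (RatFunc F) (toRat '' (Y : Set (ι → F[X])))

/-- The polynomial vectors contained in a subspace of rational function vectors. -/
noncomputable def polyPart (V : Submodule (RatFunc F) (ι → RatFunc F)) :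
    Submodule F (ι → F[X]) where
  carrier := {f | toRat f ∈ V}
  add_mem' {f g} hf hg := by
    have : toRat (f + g) = toRat f + toRat g := by ext j; simp [toRat]
    change toRat (f + g) ∈ V
    rw [this]
    exact V.add_mem hf hg
  zero_mem' := by
    have : toRat (0 : ι → F[X]) = 0 := by ext j; simp [toRat]
    change toRat (0 : ι → F[X]) ∈ V
    rw [this]
    exact V.zero_mem
  smul_mem' a f hf := by
    have : toRat (a • f) = (algebraMap F[X] (RatFunc F) (C a)) • toRat f := by
      ext j; simp [toRat, smul_eq_C_mul]
    change toRat (a • f) ∈ V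
    rw [this]
    exact V.smul_mem _ hf

theorem le_polyPart_ratSpan (Y : Submodule F (ι → F[X])) : Y ≤ polyPart (ratSpan Y) :=
  fun f hf => Submodule.subset_span ⟨f, hf, rfl⟩

theorem ratSpan_mono {Y Y' : Submodule F (ι → F[X])} (h : Y ≤ Y') : ratSpan Y ≤ ratSpan Y' :=
  Submodule.span_mono (Set.image_mono h)

theorem ratSpan_le_of_le_polyPart {Y : Submodule F (ι → F[X])}
    {V : Submodule (RatFunc F) (ι → RatFunc F)} (h : Y ≤ polyPart V) : ratSpan Y ≤ V := by
  refine Submodule.span_le.2 ?_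
  rintro _ ⟨f, hf, rfl⟩
  exact h hf

theorem ratSpan_ne_bot {Y : Submodule F (ι → F[X])} (h : Y ≠ ⊥) : ratSpan Y ≠ ⊥ := by
  obtain ⟨f, hf, hf0⟩ := Submodule.exists_mem_ne_zero_of_ne_bot h
  intro hb
  have h1 : toRat f ∈ ratSpan Y := Submodule.subset_span ⟨f, hf, rfl⟩
  rw [hb, Submodule.mem_bot] at h1
  refine hf0 (funext fun j => ?_)
  simpa [toRat] using congrFun h1 j

/-- Vectors of polynomials of degree less than `k`. -/
noncomputable def polyVecLT (F ι : Type*) [Field F] (k : ℕ) : Submodule F (ι → F[X]) :=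
  Submodule.pi Set.univ fun _ => degreeLT F k

theorem mem_polyVecLT {k : ℕ} {f : ι → F[X]} :
    f ∈ polyVecLT F ι k ↔ ∀ j, f j ∈ degreeLT F k := by
  simp [polyVecLT, Submodule.mem_pi]

instance [Finite ι] (k : ℕ) : FiniteDimensional F (polyVecLT F ι k) := by
  have : FiniteDimensional F (degreeLT F k) :=
    LinearEquiv.finiteDimensional (degreeLTEquiv F k).symm
  let g : (polyVecLT F ι k) →ₗ[F] (ι → degreeLT F k) :=
    { toFun := fun f j => ⟨f.1 j, mem_polyVecLT.1 f.2 j⟩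
      map_add' := fun _ _ => rfl
      map_smul' := fun _ _ => rfl }
  refine FiniteDimensional.of_injective g fun f f' h => ?_
  ext1
  ext1 j
  exact congrArg Subtype.val (congrFun h j)

theorem finiteDimensional_of_le_polyVecLT [Finite ι] {k : ℕ} {Y : Submodule F (ι → F[X])}
    (h : Y ≤ polyVecLT F ι k) : FiniteDimensional F Y :=
  Submodule.finiteDimensional_of_le h

/-- Project to a coordinate that does not vanish on V: the image consists of polynomials of degree <
k, hence has dimension at most k, and the kernel lies in a subspace of V of rank one less. -/
theorem finrank_inf_polyPart_le [Finite ι] (k : ℕ) (r : ℕ) :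
    ∀ V : Submodule (RatFunc F) (ι → RatFunc F), finrank (RatFunc F) V = r →
    finrank F (polyVecLT F ι k ⊓ polyPart V : Submodule F (ι → F[X])) ≤ k * r := by
  induction r with
  | zero =>
    intro V hV
    have hV0 : V = ⊥ := Submodule.finrank_eq_zero.1 hV
    have : (polyVecLT F ι k ⊓ polyPart V : Submodule F (ι → F[X])) = ⊥ := by
      rw [eq_bot_iff]
      rintro f ⟨-, hf⟩
      have hf' : toRat f ∈ V := hf
      rw [hV0, Submodule.mem_bot] at hf'
      refine (Submodule.mem_bot F).2 (funext fun j => ?_)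
      simpa [toRat] using congrFun hf' j
    rw [this]
    simp
  | succ r ih =>
    intro V hV
    have hne : V ≠ ⊥ := by
      rintro rfl
      simp at hV
    obtain ⟨v, hv, hv0⟩ := Submodule.exists_mem_ne_zero_of_ne_bot hne
    obtain ⟨j, hj⟩ := Function.ne_iff.1 hv0
    let p : (ι → RatFunc F) →ₗ[RatFunc F] RatFunc F := LinearMap.proj j
    have h1 := finrank_map_add_finrank_inf_ker p V
    have h2 : V.map p = ⊤ := by
      rcases eq_bot_or_eq_top (V.map p) with h | h
      · exfalso
        have : p v ∈ V.map p := Submodule.mem_map_of_mem hv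
        rw [h, Submodule.mem_bot] at this
        exact hj this
      · exact h
    rw [h2, finrank_top, finrank_self, hV] at h1
    have h3 := ih (V ⊓ LinearMap.ker p) (by omega)
    have := finiteDimensional_of_le_polyVecLT
      (inf_le_left : (polyVecLT F ι k ⊓ polyPart V : Submodule F (ι → F[X])) ≤ _)
    have h4 := finrank_map_add_finrank_inf_ker (LinearMap.proj j : (ι → F[X]) →ₗ[F] F[X])
      (polyVecLT F ι k ⊓ polyPart V)
    have h5 : finrank F ((polyVecLT F ι k ⊓ polyPart V).map
        (LinearMap.proj j : (ι → F[X]) →ₗ[F] F[X])) ≤ k := by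
      have hfd : FiniteDimensional F (degreeLT F k) :=
        LinearEquiv.finiteDimensional (degreeLTEquiv F k).symm
      have : finrank F (degreeLT F k) = k := by
        rw [(degreeLTEquiv F k).finrank_eq]; simp
      refine le_trans (Submodule.finrank_mono ?_) this.le
      rintro _ ⟨f, hf, rfl⟩
      exact mem_polyVecLT.1 hf.1 j
    have h6 : finrank F ((polyVecLT F ι k ⊓ polyPart V) ⊓
        LinearMap.ker (LinearMap.proj j : (ι → F[X]) →ₗ[F] F[X]) : Submodule F (ι → F[X]))
        ≤ k * r := by
      have := finiteDimensional_of_le_polyVecLT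
        (inf_le_left : (polyVecLT F ι k ⊓ polyPart (V ⊓ LinearMap.ker p) :
          Submodule F (ι → F[X])) ≤ _)
      refine le_trans (Submodule.finrank_mono ?_) h3
      rintro f ⟨⟨hf1, hf2⟩, hf3⟩
      refine ⟨hf1, hf2, ?_⟩
      have : f j = 0 := hf3
      simp [p, toRat, this]
    rw [mul_add, mul_one]
    omega

variable [DecidableEq ι]

/-- Differences on `S` of the evaluations of a polynomial vector at `x`. -/
noncomputable def evalDiff (S : Finset ι) (x : F) : (ι → F[X]) →ₗ[F] (ι × ι → F) :=
  diffOn F S ∘ₗ LinearMap.pi fun j => leval x ∘ₗ LinearMap.proj j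

theorem evalDiff_apply (S : Finset ι) (x : F) (f : ι → F[X]) (p : ι × ι) :
    evalDiff S x f p = (diffOn F[X] S f p).eval x := by
  exact diffOn_map (evalRingHom x) S f p

theorem evalDiff_eq_zero_iff (S : Finset ι) (x : F) (f : ι → F[X]) :
    evalDiff S x f = 0 ↔ ∀ j ∈ S, ∀ j' ∈ S, (f j).eval x = (f j').eval x := by
  simp only [evalDiff, LinearMap.comp_apply, diffOn_eq_zero_iff]
  rfl

/-- A maximal nonvanishing minor of the differences of vectors in Y is a nonzero polynomial of
controlled degree. Off its roots, specialisation at x preserves the generic rank. -/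
theorem card_rank_deficient_le [Fintype ι] [Fintype F] [DecidableEq F] (k : ℕ) (S : Finset ι)
    (Y : Submodule F (ι → F[X])) (hY : Y ≤ polyVecLT F ι k) :
    (Finset.univ.filter fun x : F => finrank F Y <
      finrank F (Y ⊓ LinearMap.ker (evalDiff S x) : Submodule F (ι → F[X])) +
        finrank (RatFunc F) ((ratSpan Y).map (diffOn (RatFunc F) S))).card
      ≤ k * finrank (RatFunc F) (ratSpan Y) := by
  classical
  have hfd := finiteDimensional_of_le_polyVecLT hY
  set Z : Set (ι × ι → RatFunc F) := (diffOn (RatFunc F) S) '' (toRat '' (Y : Set (ι → F[X])))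
    with hZ
  have hmap : (ratSpan Y).map (diffOn (RatFunc F) S) = Submodule.span (RatFunc F) Z := by
    rw [ratSpan, Submodule.map_span]
  set r := finrank (RatFunc F) ((ratSpan Y).map (diffOn (RatFunc F) S)) with hr
  obtain ⟨g, hgY, hgli⟩ : ∃ g : Fin r → (ι → F[X]), (∀ i, g i ∈ Y) ∧
      LinearIndependent (RatFunc F) fun i => diffOn (RatFunc F) S (toRat (g i)) := by
    obtain ⟨b, hbZ, hbspan, hbli⟩ := exists_linearIndependent (RatFunc F) Z
    have hbf : b.Finite := hbli.setFinite
    have := hbf.fintype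
    have hcard : Fintype.card b = r := by
      rw [hr, hmap, ← hbspan, ← finrank_span_eq_card hbli, Subtype.range_coe]
    let e : Fin r ≃ b := (Fintype.equivFinOfCardEq hcard).symm
    have hch : ∀ i : Fin r, ∃ f ∈ Y, diffOn (RatFunc F) S (toRat f) = (e i : ι × ι → RatFunc F) := by
      intro i
      obtain ⟨_, ⟨f, hf, rfl⟩, h⟩ := hbZ (e i).2
      exact ⟨f, hf, h⟩
    choose g hg hge using hch
    refine ⟨g, hg, ?_⟩
    have := hbli.comp e e.injective
    have hfun : (fun i => diffOn (RatFunc F) S (toRat (g i))) = Subtype.val ∘ e := funext hge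
    rw [hfun]
    exact this
  obtain ⟨c, hc⟩ := exists_det_ne_zero_of_linearIndependent _ hgli
  set P : Matrix (Fin r) (Fin r) F[X] := Matrix.of fun i j => diffOn F[X] S (g i) (c j) with hP
  have hPdet : P.det ≠ 0 := by
    intro h0
    apply hc
    have : (Matrix.of fun i j => diffOn (RatFunc F) S (toRat (g i)) (c j)) =
        (algebraMap F[X] (RatFunc F)).mapMatrix P := by
      ext i j
      exact diffOn_map (algebraMap F[X] (RatFunc F)) S (g i) (c j)
    rw [this, ← RingHom.map_det, h0, map_zero]
  -- Each entry is a difference of polynomials of degree < k, or zero.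
  have hdeg : P.det.natDegree ≤ k * r := by
    rw [Matrix.det_apply]
    refine natDegree_sum_le_of_forall_le _ _ fun σ _ => ?_
    refine (natDegree_smul_le _ _).trans ?_
    refine (natDegree_prod_le _ _).trans ?_
    refine (Finset.sum_le_card_nsmul _ _ k fun i _ => ?_).trans ?_
    · rw [hP, Matrix.of_apply, diffOn_apply]
      split_ifs
      · have h1 := mem_polyVecLT.1 (hY (hgY (σ i))) (c i).1
        have h2 := mem_polyVecLT.1 (hY (hgY (σ i))) (c i).2
        have h3 := mem_degreeLT.1 (Submodule.sub_mem _ h1 h2)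
        exact natDegree_le_of_degree_le h3.le
      · simp
    · simp [mul_comm]
  have hr' : r ≤ finrank (RatFunc F) (ratSpan Y) := Submodule.finrank_map_le _ _
  refine le_trans ?_ (Nat.mul_le_mul_left k hr')
  refine le_trans ?_ hdeg
  refine le_trans ?_ (P.det.card_roots')
  refine le_trans (Finset.card_le_card ?_) (Multiset.toFinset_card_le _)
  intro x hx
  rw [Finset.mem_filter] at hx
  rw [Multiset.mem_toFinset, mem_roots hPdet, IsRoot.def]
  by_contra hne
  refine absurd hx.2 (not_lt.2 ?_)
  rw [add_comm, ← finrank_map_add_finrank_inf_ker (evalDiff S x) Y]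
  refine Nat.add_le_add_right ?_ _
  have hli : LinearIndependent F fun i => evalDiff S x (g i) := by
    have hQ : ((evalRingHom x).mapMatrix P).det ≠ 0 := by
      rw [← RingHom.map_det]; exact hne
    have hrows : LinearIndependent F ((evalRingHom x).mapMatrix P).row :=
      Matrix.linearIndependent_rows_of_det_ne_zero hQ
    refine LinearIndependent.of_comp (LinearMap.funLeft F F c) ?_
    convert hrows using 1
    ext i j
    exact evalDiff_apply S x (g i) (c j)
  have := finrank_span_eq_card hli
  rw [Fintype.card_fin] at this
  rw [← this]
  refine Submodule.finrank_mono (Submodule.span_le.2 ?_)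
  rintro _ ⟨i, rfl⟩
  exact Submodule.mem_map_of_mem (hgY i)

end PolyVectors

/-! ### Solution spaces and deficient constraints. -/

section SolutionSpaces

variable {F ι : Type*} [Field F] [DecidableEq ι] {n : ℕ}

/-- The polynomial vectors in `W₀` whose evaluation at `α i` is constant on `S i`, for `i ∈ T`. -/
noncomputable def solSpace (W₀ : Submodule F (ι → F[X])) (S : Fin n → Finset ι) (α : Fin n → F)
    (T : Finset (Fin n)) : Submodule F (ι → F[X]) :=
  W₀ ⊓ ⨅ i ∈ T, LinearMap.ker (evalDiff (S i) (α i))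

theorem mem_solSpace {W₀ : Submodule F (ι → F[X])} {S : Fin n → Finset ι} {α : Fin n → F}
    {T : Finset (Fin n)} {f : ι → F[X]} :
    f ∈ solSpace W₀ S α T ↔ f ∈ W₀ ∧ ∀ i ∈ T, evalDiff (S i) (α i) f = 0 := by
  simp [solSpace, Submodule.mem_iInf]

theorem solSpace_le (W₀ : Submodule F (ι → F[X])) (S : Fin n → Finset ι) (α : Fin n → F)
    (T : Finset (Fin n)) : solSpace W₀ S α T ≤ W₀ := inf_le_left

theorem solSpace_anti (W₀ : Submodule F (ι → F[X])) (S : Fin n → Finset ι) (α : Fin n → F)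
    {T T' : Finset (Fin n)} (h : T ⊆ T') : solSpace W₀ S α T' ≤ solSpace W₀ S α T := by
  intro f hf
  rw [mem_solSpace] at hf ⊢
  exact ⟨hf.1, fun i hi => hf.2 i (h hi)⟩

theorem solSpace_congr (W₀ : Submodule F (ι → F[X])) (S : Fin n → Finset ι) {α α' : Fin n → F}
    {T : Finset (Fin n)} (h : ∀ i ∈ T, α i = α' i) : solSpace W₀ S α T = solSpace W₀ S α' T := by
  ext f
  rw [mem_solSpace, mem_solSpace]
  refine and_congr_right fun _ => forall₂_congr fun i hi => ?_
  rw [h i hi]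

theorem solSpace_empty (W₀ : Submodule F (ι → F[X])) (S : Fin n → Finset ι) (α : Fin n → F) :
    solSpace W₀ S α ∅ = W₀ := by
  ext f
  simp [mem_solSpace]

theorem solSpace_insert (W₀ : Submodule F (ι → F[X])) (S : Fin n → Finset ι) (α : Fin n → F)
    (T : Finset (Fin n)) (s : Fin n) :
    solSpace W₀ S α (insert s T) = solSpace W₀ S α T ⊓ LinearMap.ker (evalDiff (S s) (α s)) := by
  ext f
  simp only [mem_solSpace, Submodule.mem_inf, Finset.forall_mem_insert, LinearMap.mem_ker]
  tauto

/-- The solutions of the constraints preceding `s` in `T` that lie in `V`. -/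
noncomputable def prefixSpace (W₀ : Submodule F (ι → F[X])) (S : Fin n → Finset ι) (α : Fin n → F)
    (V : Submodule (RatFunc F) (ι → RatFunc F)) (T : Finset (Fin n)) (s : Fin n) :
    Submodule F (ι → F[X]) :=
  solSpace W₀ S α (T.filter (· < s)) ⊓ polyPart V

/-- The constraint at `s` cuts the dimension of the prefix solution space in `V` by less than it
does for a generic evaluation point. -/
def IsDeficient (W₀ : Submodule F (ι → F[X])) (S : Fin n → Finset ι) (α : Fin n → F)
    (V : Submodule (RatFunc F) (ι → RatFunc F)) (T : Finset (Fin n)) (s : Fin n) : Prop :=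
  finrank F (prefixSpace W₀ S α V T s) <
    finrank F (prefixSpace W₀ S α V T s ⊓ LinearMap.ker (evalDiff (S s) (α s)) :
      Submodule F (ι → F[X])) + finrank (RatFunc F) (V.map (diffOn (RatFunc F) (S s)))

-- Impose the constraints in increasing order. A nondeficient one lowers the dimension by at least
-- its generic rank; a deficient one does not raise it.
open Classical in
theorem finrank_solSpace_add_sum_le [Finite ι] {k : ℕ} {W₀ : Submodule F (ι → F[X])}
    (hW : W₀ ≤ polyVecLT F ι k) (S : Fin n → Finset ι) (α : Fin n → F)
    (V : Submodule (RatFunc F) (ι → RatFunc F)) (T : Finset (Fin n)) :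
    finrank F (solSpace W₀ S α T ⊓ polyPart V : Submodule F (ι → F[X])) +
      ∑ s ∈ T.filter (fun s => ¬ IsDeficient W₀ S α V T s),
        finrank (RatFunc F) (V.map (diffOn (RatFunc F) (S s))) ≤
      finrank F (W₀ ⊓ polyPart V : Submodule F (ι → F[X])) := by
  induction T using Finset.induction_on_max with
  | empty =>
    rw [Finset.filter_empty, Finset.sum_empty, add_zero, solSpace_empty]
  | insert a T ha ih =>
    have haT : a ∉ T := fun h => lt_irrefl _ (ha a h)
    have hpre : ∀ s ∈ T, (insert a T).filter (· < s) = T.filter (· < s) := by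
      intro s hs
      rw [Finset.filter_insert, if_neg (not_lt.2 (ha s hs).le)]
    have hprea : (insert a T).filter (· < a) = T := by
      rw [Finset.filter_insert, if_neg (lt_irrefl _)]
      exact Finset.filter_true_of_mem ha
    have hdef : ∀ s ∈ T, (IsDeficient W₀ S α V (insert a T) s ↔ IsDeficient W₀ S α V T s) := by
      intro s hs
      rw [IsDeficient, IsDeficient, prefixSpace, prefixSpace, hpre s hs]
    have hfil : T.filter (fun s => ¬ IsDeficient W₀ S α V (insert a T) s) =
        T.filter (fun s => ¬ IsDeficient W₀ S α V T s) :=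
      Finset.filter_congr fun s hs => not_congr (hdef s hs)
    have hins : (solSpace W₀ S α (insert a T) ⊓ polyPart V : Submodule F (ι → F[X])) =
        (solSpace W₀ S α T ⊓ polyPart V) ⊓ LinearMap.ker (evalDiff (S a) (α a)) := by
      rw [solSpace_insert, inf_right_comm]
    rw [Finset.filter_insert, hfil]
    by_cases hgood : IsDeficient W₀ S α V (insert a T) a
    · rw [if_neg (not_not.2 hgood)]
      refine le_trans (Nat.add_le_add_right ?_ _) ih
      have := finiteDimensional_of_le_polyVecLT (inf_le_left.trans ((solSpace_le W₀ S α T).trans hW) :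
        (solSpace W₀ S α T ⊓ polyPart V : Submodule F (ι → F[X])) ≤ _)
      refine Submodule.finrank_mono ?_
      rw [hins]
      exact inf_le_left
    · rw [if_pos hgood]
      rw [Finset.sum_insert (fun h => haT (Finset.mem_filter.1 h).1), ← add_assoc]
      refine le_trans (Nat.add_le_add_right ?_ _) ih
      rw [IsDeficient, not_lt, prefixSpace, hprea, ← hins] at hgood
      exact hgood

-- The nondeficient constraints account for at most k dim V of the sum in `hδ`. Every other index,
-- deficient or outside T, contributes at most dim V.
open Classical in
theorem le_card_deficient [Finite ι] {k : ℕ} {W₀ : Submodule F (ι → F[X])}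
    (hW : W₀ ≤ polyVecLT F ι k) (S : Fin n → Finset ι) {δ : ℝ}
    (α : Fin n → F) (V : Submodule (RatFunc F) (ι → RatFunc F)) (hV : V ≠ ⊥)
    (hδ : ((k : ℝ) + δ) * finrank (RatFunc F) V ≤
      ∑ i, (finrank (RatFunc F) (V.map (diffOn (RatFunc F) (S i))) : ℝ))
    (T : Finset (Fin n)) :
    δ ≤ ((T.filter fun s => IsDeficient W₀ S α V T s).card : ℝ) + (Tᶜ.card : ℝ) := by
  set r := finrank (RatFunc F) V with hr
  have hr0 : 0 < (r : ℝ) := by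
    have : r ≠ 0 := fun h => hV (Submodule.finrank_eq_zero.1 h)
    exact_mod_cast Nat.pos_of_ne_zero this
  set e : Fin n → ℕ := fun i => finrank (RatFunc F) (V.map (diffOn (RatFunc F) (S i))) with he
  have her : ∀ i, e i ≤ r := fun i => Submodule.finrank_map_le _ _
  have h1 := finrank_solSpace_add_sum_le hW S α V T
  have h2 : finrank F (W₀ ⊓ polyPart V : Submodule F (ι → F[X])) ≤ k * r := by
    have := finiteDimensional_of_le_polyVecLT
      (inf_le_left : (polyVecLT F ι k ⊓ polyPart V : Submodule F (ι → F[X])) ≤ _)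
    exact (Submodule.finrank_mono (inf_le_inf_right _ hW)).trans (finrank_inf_polyPart_le k r V rfl)
  have h3 : ∑ s ∈ T.filter (fun s => ¬ IsDeficient W₀ S α V T s), e s ≤ k * r :=
    (Nat.le_add_left _ _).trans (h1.trans h2)
  have h4 : ∑ s ∈ T.filter (fun s => IsDeficient W₀ S α V T s), e s ≤
      (T.filter fun s => IsDeficient W₀ S α V T s).card * r :=
    Finset.sum_le_card_nsmul _ _ _ fun i _ => her i
  have h5 : ∑ s ∈ Tᶜ, e s ≤ Tᶜ.card * r := Finset.sum_le_card_nsmul _ _ _ fun i _ => her i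
  have h6 : ∑ i, e i = ∑ s ∈ T.filter (fun s => IsDeficient W₀ S α V T s), e s +
      ∑ s ∈ T.filter (fun s => ¬ IsDeficient W₀ S α V T s), e s + ∑ s ∈ Tᶜ, e s := by
    rw [Finset.sum_filter_add_sum_filter_not, Finset.sum_add_sum_compl]
  have h7 : ∑ i, e i ≤ ((T.filter fun s => IsDeficient W₀ S α V T s).card + Tᶜ.card + k) * r := by
    rw [h6, add_mul, add_mul]; omega
  have h8 : (∑ i, (e i : ℝ)) ≤
      (((T.filter fun s => IsDeficient W₀ S α V T s).card : ℝ) + (Tᶜ.card : ℝ) + k) * r := by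
    exact_mod_cast h7
  have h9 := le_of_mul_le_mul_right (hδ.trans h8) hr0
  linarith

end SolutionSpaces

/-! ### Counting evaluation points coordinate by coordinate. -/

section Counting

variable {F : Type*} [Fintype F] {n : ℕ}

theorem ncard_ofPred_eq_card_filter {β : Type*} [Fintype β] (p : β → Prop) [DecidablePred p] :
    {b | p b}.ncard = (Finset.univ.filter p).card := by
  rw [← Set.ncard_coe_finset]
  congr 1
  ext b
  simp

/-- Swapping coordinate s of β with a free value y is injective, and sends each β satisfying both
conditions to a vector still satisfying G together with a value of coordinate s that makes Q hold.
-/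
theorem card_mul_ncard_and_le {D : ℕ} (G Q : (Fin n → F) → Prop) (s : Fin n)
    (hG : ∀ α x, G (Function.update α s x) ↔ G α)
    (hQ : ∀ α, {x | Q (Function.update α s x)}.ncard ≤ D) :
    Fintype.card F * {α | G α ∧ Q α}.ncard ≤ D * {α | G α}.ncard := by
  classical
  simp only [ncard_ofPred_eq_card_filter] at hQ ⊢
  set P : Finset (Σ _ : Fin n → F, F) := (Finset.univ.filter G).sigma
    fun α => Finset.univ.filter fun x => Q (Function.update α s x) with hP
  have h1 : P.card ≤ D * (Finset.univ.filter G).card := by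
    rw [hP, Finset.card_sigma, mul_comm]
    exact Finset.sum_le_card_nsmul _ _ _ fun α _ => hQ α
  refine le_trans ?_ h1
  rw [mul_comm, ← Finset.card_univ, ← Finset.card_product]
  refine Finset.card_le_card_of_injOn
    (fun p => ⟨Function.update p.1 s p.2, p.1 s⟩) ?_ ?_
  · rintro ⟨β, y⟩ h
    have h' := (Finset.mem_filter.1 (Finset.mem_product.1 h).1).2
    simp only [hP, Finset.coe_sigma, Set.mem_sigma_iff, Finset.coe_filter, Finset.mem_univ,
      true_and, Set.mem_ofPred_eq]
    refine ⟨(hG _ _).2 h'.1, ?_⟩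
    simpa using h'.2
  · rintro ⟨β, y⟩ - ⟨β', y'⟩ - h
    simp only [Sigma.mk.injEq, heq_eq_eq] at h
    obtain ⟨h1, h2⟩ := h
    have h3 : y = y' := by simpa using congrFun h1 s
    have h4 : β = β' := by
      funext i
      by_cases hi : i = s
      · rw [hi, h2]
      · simpa [hi] using congrFun h1 i
    rw [h3, h4]

/-- The condition at the largest index is peeled off first: neither G nor the conditions at smaller
indices see that coordinate. -/
theorem card_pow_mul_ncard_forall_le {D : ℕ} (G : (Fin n → F) → Prop)
    (Q : Fin n → (Fin n → F) → Prop) (A : Finset (Fin n))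
    (hG : ∀ s ∈ A, ∀ α x, G (Function.update α s x) ↔ G α)
    (hQ : ∀ s ∈ A, ∀ t ∈ A, s < t → ∀ α x, Q s (Function.update α t x) ↔ Q s α)
    (hD : ∀ s ∈ A, ∀ α, {x | Q s (Function.update α s x)}.ncard ≤ D) :
    Fintype.card F ^ A.card * {α | G α ∧ ∀ s ∈ A, Q s α}.ncard ≤
      D ^ A.card * {α | G α}.ncard := by
  induction A using Finset.induction_on_max with
  | empty => simp
  | insert a A ha ih =>
    have haA : a ∉ A := fun h => lt_irrefl _ (ha a h)
    have ih' := ih (fun s hs => hG s (Finset.mem_insert_of_mem hs))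
      (fun s hs t ht => hQ s (Finset.mem_insert_of_mem hs) t (Finset.mem_insert_of_mem ht))
      (fun s hs => hD s (Finset.mem_insert_of_mem hs))
    have h1 := card_mul_ncard_and_le (D := D) (fun α => G α ∧ ∀ s ∈ A, Q s α) (Q a) a
      (fun α x => and_congr (hG a (Finset.mem_insert_self _ _) α x)
        (forall₂_congr fun s hs => hQ s (Finset.mem_insert_of_mem hs) a
          (Finset.mem_insert_self _ _) (ha s hs) α x))
      (hD a (Finset.mem_insert_self _ _))
    have h2 : {α | G α ∧ ∀ s ∈ insert a A, Q s α} =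
        {α | (G α ∧ ∀ s ∈ A, Q s α) ∧ Q a α} := by
      ext α
      simp only [Set.mem_ofPred_eq, Finset.forall_mem_insert]
      tauto
    rw [h2, Finset.card_insert_of_notMem haA, pow_succ, pow_succ, mul_assoc]
    refine (Nat.mul_le_mul_left _ h1).trans ?_
    rw [mul_left_comm, mul_comm (D ^ A.card) D, mul_assoc]
    exact Nat.mul_le_mul_left _ ih'

end Counting

/-! ### Induction on the rank of the solution span. -/

section RankInduction

variable {F ι : Type*} [Field F] [DecidableEq ι] {n : ℕ}

/-- The constraint at `s` is deficient in `T` relative to the span of the solutions of the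
constraints in `T \ A`, which is also the span of the prefix solution space at `s`. -/
def IsRobustlyDeficient (W₀ : Submodule F (ι → F[X])) (S : Fin n → Finset ι)
    (T A : Finset (Fin n)) (s : Fin n) (α : Fin n → F) : Prop :=
  ratSpan (prefixSpace W₀ S α (ratSpan (solSpace W₀ S α (T \ A))) T s) =
      ratSpan (solSpace W₀ S α (T \ A)) ∧
    IsDeficient W₀ S α (ratSpan (solSpace W₀ S α (T \ A))) T s

theorem isRobustlyDeficient_update {W₀ : Submodule F (ι → F[X])} {S : Fin n → Finset ι}
    {T A : Finset (Fin n)} {s t : Fin n} (ht : t ∈ A) (hst : s < t) (α : Fin n → F) (x : F) :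
    IsRobustlyDeficient W₀ S T A s (Function.update α t x) ↔
      IsRobustlyDeficient W₀ S T A s α := by
  have h1 : solSpace W₀ S (Function.update α t x) (T \ A) = solSpace W₀ S α (T \ A) := by
    refine solSpace_congr _ _ fun i hi => Function.update_of_ne ?_ _ _
    rintro rfl
    exact (Finset.mem_sdiff.1 hi).2 ht
  have h2 : solSpace W₀ S (Function.update α t x) (T.filter (· < s)) =
      solSpace W₀ S α (T.filter (· < s)) := by
    refine solSpace_congr _ _ fun i hi => Function.update_of_ne ?_ _ _
    rintro rfl
    exact lt_asymm hst (Finset.mem_filter.1 hi).2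
  have h3 : Function.update α t x s = α s := Function.update_of_ne hst.ne _ _
  rw [IsRobustlyDeficient, IsRobustlyDeficient, IsDeficient, IsDeficient, prefixSpace, prefixSpace,
    h1, h2, h3]

/-- Since s ∈ A, varying α_s changes neither the span V nor the prefix space at s. When the prefix
space spans V, the bad values are those of `card_rank_deficient_le`; otherwise there are none. -/
theorem ncard_isRobustlyDeficient_le [Fintype F] [Fintype ι] {k d : ℕ} {W₀ : Submodule F (ι → F[X])}
    (hW : W₀ ≤ polyVecLT F ι k) (hd : finrank (RatFunc F) (ratSpan W₀) ≤ d)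
    {S : Fin n → Finset ι} {T A : Finset (Fin n)} {s : Fin n} (hs : s ∈ A) (α : Fin n → F) :
    {x | IsRobustlyDeficient W₀ S T A s (Function.update α s x)}.ncard ≤ k * d := by
  classical
  rw [ncard_ofPred_eq_card_filter]
  set V := ratSpan (solSpace W₀ S α (T \ A)) with hV
  set Y := prefixSpace W₀ S α V T s with hY
  have h1 : ∀ x, solSpace W₀ S (Function.update α s x) (T \ A) = solSpace W₀ S α (T \ A) := by
    intro x
    refine solSpace_congr _ _ fun i hi => Function.update_of_ne ?_ _ _
    rintro rfl
    exact (Finset.mem_sdiff.1 hi).2 hs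
  have h2 : ∀ x, solSpace W₀ S (Function.update α s x) (T.filter (· < s)) =
      solSpace W₀ S α (T.filter (· < s)) := by
    intro x
    refine solSpace_congr _ _ fun i hi => Function.update_of_ne ?_ _ _
    rintro rfl
    exact lt_irrefl _ (Finset.mem_filter.1 hi).2
  have h3 : ∀ x, prefixSpace W₀ S (Function.update α s x) V T s = Y := by
    intro x
    rw [hY, prefixSpace, prefixSpace, h2]
  have hYW : Y ≤ W₀ := inf_le_left.trans (solSpace_le _ _ _ _)
  by_cases hspan : ratSpan Y = V
  · refine le_trans (Finset.card_le_card ?_) ((card_rank_deficient_le k (S s) Y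
      (hYW.trans hW)).trans (Nat.mul_le_mul_left k
        ((Submodule.finrank_mono (ratSpan_mono hYW)).trans hd)))
    intro x hx
    rw [Finset.mem_filter] at hx ⊢
    have := hx.2.2
    rw [h1, IsDeficient, ← hV, h3, Function.update_self] at this
    rw [hspan]
    exact ⟨hx.1, this⟩
  · rw [Finset.card_eq_zero.2]
    · exact Nat.zero_le _
    · refine Finset.filter_eq_empty_iff.2 fun x _ hx => hspan ?_
      have := hx.1
      rwa [h1, ← hV, h3] at this

theorem ncard_robustlyDeficient_le [Fintype F] [Fintype ι] {k d : ℕ}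
    {W₀ : Submodule F (ι → F[X])}
    (hW : W₀ ≤ polyVecLT F ι k) (hd : finrank (RatFunc F) (ratSpan W₀) ≤ d)
    (S : Fin n → Finset ι) (T A : Finset (Fin n)) (G : (Fin n → F) → Prop)
    (hG : ∀ s ∈ A, ∀ α x, G (Function.update α s x) ↔ G α) :
    ({α | G α ∧ ∀ s ∈ A, IsRobustlyDeficient W₀ S T A s α}.ncard : ℝ) ≤
      ((k * d : ℕ) / (Fintype.card F : ℝ)) ^ A.card * ({α | G α}.ncard : ℝ) := by
  have h := card_pow_mul_ncard_forall_le G (IsRobustlyDeficient W₀ S T A) A hG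
    (fun s _ t ht hst α x => isRobustlyDeficient_update ht hst α x)
    (fun s hs α => ncard_isRobustlyDeficient_le hW hd hs α)
  have hq : (0 : ℝ) < Fintype.card F := by exact_mod_cast Fintype.card_pos
  have h' : (Fintype.card F : ℝ) ^ A.card *
      ({α | G α ∧ ∀ s ∈ A, IsRobustlyDeficient W₀ S T A s α}.ncard : ℝ) ≤
      ((k * d : ℕ) : ℝ) ^ A.card * ({α | G α}.ncard : ℝ) := by exact_mod_cast h
  rw [div_pow, div_mul_eq_mul_div, le_div_iff₀ (pow_pos hq _), mul_comm]
  exact h'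

-- A is a largest set of deficient constraints whose removal keeps the span. By maximality, removing
-- any further deficient constraint strictly enlarges it.
open Classical in
theorem exists_robustlyDeficient [Finite ι] {k m : ℕ} {W₀ : Submodule F (ι → F[X])}
    (hW : W₀ ≤ polyVecLT F ι k) (S : Fin n → Finset ι) {δ : ℝ}
    (hδ : ∀ V ≤ ratSpan W₀, ((k : ℝ) + δ) * finrank (RatFunc F) V ≤
      ∑ i, (finrank (RatFunc F) (V.map (diffOn (RatFunc F) (S i))) : ℝ))
    (T : Finset (Fin n)) (hm : (m : ℝ) + (Tᶜ.card : ℝ) ≤ δ) (α : Fin n → F)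
    (hne : ratSpan (solSpace W₀ S α T) ≠ ⊥) :
    ∃ A ⊆ T, (∀ s ∈ A, IsRobustlyDeficient W₀ S T A s α) ∧
      (m ≤ A.card ∨ A.card < m ∧ ∃ s ∈ T \ A,
        finrank (RatFunc F) (ratSpan (solSpace W₀ S α T)) <
          finrank (RatFunc F) (ratSpan (solSpace W₀ S α (T \ insert s A)))) := by
  set V := ratSpan (solSpace W₀ S α T) with hV
  have hVW : V ≤ ratSpan W₀ := ratSpan_mono (solSpace_le _ _ _ _)
  set B := T.filter fun s => IsDeficient W₀ S α V T s with hB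
  have hmB : m ≤ B.card := by
    have := le_card_deficient hW S α V hne (hδ V hVW) T
    have h2 : (m : ℝ) ≤ (B.card : ℝ) := by linarith
    exact_mod_cast h2
  obtain ⟨A, hA, hmax⟩ := Finset.exists_max_image
    (B.powerset.filter fun A => ratSpan (solSpace W₀ S α (T \ A)) = V) Finset.card
    ⟨∅, by simp [hV]⟩
  rw [Finset.mem_filter, Finset.mem_powerset] at hA
  obtain ⟨hAB, hAV⟩ := hA
  have hBT : B ⊆ T := Finset.filter_subset _ _
  refine ⟨A, hAB.trans hBT, fun s hs => ?_, ?_⟩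
  · rw [IsRobustlyDeficient, hAV]
    -- The prefix space lies in V and contains all solutions for T, so it spans V.
    refine ⟨le_antisymm (ratSpan_le_of_le_polyPart inf_le_right) ?_,
      (Finset.mem_filter.1 (hAB hs)).2⟩
    refine ratSpan_mono (le_inf (solSpace_anti _ _ _ (Finset.filter_subset _ _)) ?_)
    exact le_polyPart_ratSpan _
  · rcases le_or_gt m A.card with h | h
    · exact Or.inl h
    · refine Or.inr ⟨h, ?_⟩
      obtain ⟨s, hsB, hsA⟩ := Finset.exists_mem_notMem_of_card_lt_card (h.trans_le hmB)
      refine ⟨s, Finset.mem_sdiff.2 ⟨hBT hsB, hsA⟩, ?_⟩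
      refine Submodule.finrank_lt_finrank_of_lt (lt_of_le_of_ne
        (ratSpan_mono (solSpace_anti _ _ _ Finset.sdiff_subset)) fun heq => ?_)
      have := hmax (insert s A) (Finset.mem_filter.2 ⟨Finset.mem_powerset.2
        (Finset.insert_subset hsB hAB), heq.symm⟩)
      rw [Finset.card_insert_of_notMem hsA] at this
      omega

/-- Here j measures how far the rank may fall below d + 1, so j = 0 is impossible. Each step pays
x^|A| for the robust set and loses one constraint, whence the exponent m - j; the union over A and
the extra index costs 2^(2n). -/
theorem ncard_solSpace_rank_le [Fintype F] [Fintype ι] {k d : ℕ} {W₀ : Submodule F (ι → F[X])}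
    (hW : W₀ ≤ polyVecLT F ι k) (hd : finrank (RatFunc F) (ratSpan W₀) ≤ d)
    (hD : k * d ≤ Fintype.card F) (S : Fin n → Finset ι) {δ : ℝ}
    (hδ : ∀ V ≤ ratSpan W₀, ((k : ℝ) + δ) * finrank (RatFunc F) V ≤
      ∑ i, (finrank (RatFunc F) (V.map (diffOn (RatFunc F) (S i))) : ℝ)) (j : ℕ) :
    ∀ (T : Finset (Fin n)) (m : ℕ), (m : ℝ) + (Tᶜ.card : ℝ) ≤ δ →
    ({α : Fin n → F | ratSpan (solSpace W₀ S α T) ≠ ⊥ ∧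
      d + 1 ≤ finrank (RatFunc F) (ratSpan (solSpace W₀ S α T)) + j}.ncard : ℝ) ≤
      2 ^ (2 * n * j) * ((k * d : ℕ) / (Fintype.card F : ℝ)) ^ (m - j) *
        (Fintype.card F : ℝ) ^ n := by
  classical
  set x : ℝ := (k * d : ℕ) / (Fintype.card F : ℝ) with hx
  set q : ℝ := (Fintype.card F : ℝ) with hqdef
  have hq : (0 : ℝ) < q := by rw [hqdef]; exact_mod_cast Fintype.card_pos
  have hx0 : 0 ≤ x := by positivity
  have hx1 : x ≤ 1 := by
    rw [hx, div_le_one hq, hqdef]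
    exact_mod_cast hD
  induction j with
  | zero =>
    intro T m _
    have : {α : Fin n → F | ratSpan (solSpace W₀ S α T) ≠ ⊥ ∧
        d + 1 ≤ finrank (RatFunc F) (ratSpan (solSpace W₀ S α T)) + 0} = ∅ := by
      refine Set.eq_empty_of_forall_notMem fun α hα => ?_
      have h1 := (Submodule.finrank_mono (ratSpan_mono (solSpace_le W₀ S α T))).trans hd
      have h2 := hα.2
      omega
    rw [this, Set.ncard_empty, Nat.cast_zero]
    positivity
  | succ j ih =>
    intro T m hm
    -- `none`: A is already large enough. `some s`: dropping s as well raises the rank. Neither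
    -- event depends on the coordinates in A, so each can be conditioned on.
    let G : Option (Fin n) → Finset (Fin n) → (Fin n → F) → Prop := fun o A α =>
      match o with
      | none => m ≤ A.card
      | some s => A.card < m ∧ s ∈ T \ A ∧ ratSpan (solSpace W₀ S α (T \ insert s A)) ≠ ⊥ ∧
          d + 1 ≤ finrank (RatFunc F) (ratSpan (solSpace W₀ S α (T \ insert s A))) + j
    let Ev : Finset (Fin n) × Option (Fin n) → Set (Fin n → F) := fun p =>
      {α | (p.1 ⊆ T ∧ G p.2 p.1 α) ∧ ∀ s ∈ p.1, IsRobustlyDeficient W₀ S T p.1 s α}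
    have hcover : {α : Fin n → F | ratSpan (solSpace W₀ S α T) ≠ ⊥ ∧
        d + 1 ≤ finrank (RatFunc F) (ratSpan (solSpace W₀ S α T)) + (j + 1)} ⊆
        ⋃ p ∈ (Finset.univ : Finset (Finset (Fin n) × Option (Fin n))), Ev p := by
      rintro α ⟨hne, hrk⟩
      simp only [Finset.mem_univ, Set.iUnion_true, Set.mem_iUnion]
      obtain ⟨A, hAT, hAdef, h | ⟨h, s, hs, hlt⟩⟩ := exists_robustlyDeficient hW S hδ T hm α hne
      · exact ⟨(A, none), ⟨hAT, h⟩, hAdef⟩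
      · have h2 : d + 1 ≤ finrank (RatFunc F) (ratSpan (solSpace W₀ S α (T \ insert s A))) + j := by
          omega
        refine ⟨(A, some s), ⟨hAT, h, hs, ?_, h2⟩, hAdef⟩
        intro hb
        rw [hb] at hlt
        simp at hlt
    have hEv : ∀ p ∈ (Finset.univ : Finset (Finset (Fin n) × Option (Fin n))),
        ((Ev p).ncard : ℝ) ≤ 2 ^ (2 * n * j) * x ^ (m - (j + 1)) * q ^ n := by
      rintro ⟨A, o⟩ -
      have hGinv : ∀ s ∈ A, ∀ (α : Fin n → F) (y : F),
          (A ⊆ T ∧ G o A (Function.update α s y)) ↔ (A ⊆ T ∧ G o A α) := by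
        intro s hs α y
        rcases o with _ | t
        · exact Iff.rfl
        · have : solSpace W₀ S (Function.update α s y) (T \ insert t A) =
              solSpace W₀ S α (T \ insert t A) := by
            refine solSpace_congr _ _ fun i hi => Function.update_of_ne ?_ _ _
            rintro rfl
            exact (Finset.mem_sdiff.1 hi).2 (Finset.mem_insert_of_mem hs)
          change (A ⊆ T ∧ _ ∧ _ ∧ _ ∧ _) ↔ (A ⊆ T ∧ _ ∧ _ ∧ _ ∧ _)
          rw [this]
      refine (ncard_robustlyDeficient_le hW hd S T A (fun α => A ⊆ T ∧ G o A α) hGinv).trans ?_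
      rw [← hx]
      have htriv : ({α : Fin n → F | A ⊆ T ∧ G o A α}.ncard : ℝ) ≤ q ^ n := by
        have := Set.ncard_le_card {α : Fin n → F | A ⊆ T ∧ G o A α}
        rw [Nat.card_eq_fintype_card, Fintype.card_fun, Fintype.card_fin] at this
        rw [hqdef]
        exact_mod_cast this
      have hone : (1 : ℝ) ≤ 2 ^ (2 * n * j) := one_le_pow₀ (by norm_num)
      rcases o with _ | s
      · by_cases hA : m ≤ A.card
        · calc x ^ A.card * _ ≤ x ^ (m - (j + 1)) * q ^ n := by
                refine mul_le_mul ?_ htriv (by positivity) (by positivity)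
                exact pow_le_pow_of_le_one hx0 hx1 (by omega)
            _ ≤ 2 ^ (2 * n * j) * (x ^ (m - (j + 1)) * q ^ n) :=
                le_mul_of_one_le_left (by positivity) hone
            _ = _ := by ring
        · have : {α : Fin n → F | A ⊆ T ∧ G none A α} = ∅ :=
            Set.eq_empty_of_forall_notMem fun α hα => hA hα.2
          rw [this, Set.ncard_empty, Nat.cast_zero, mul_zero]
          positivity
      · by_cases hA : A ⊆ T ∧ A.card < m ∧ s ∈ T \ A
        · obtain ⟨hAT, hAm, hs⟩ := hA
          have hsA := (Finset.mem_sdiff.1 hs).2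
          have hsub : insert s A ⊆ T := Finset.insert_subset (Finset.mem_sdiff.1 hs).1 hAT
          have hc : (T \ insert s A)ᶜ.card = Tᶜ.card + (A.card + 1) := by
            have e1 := Finset.card_compl (T \ insert s A)
            have e2 := Finset.card_compl T
            have e3 := Finset.card_sdiff_of_subset hsub
            have e4 := Finset.card_insert_of_notMem hsA
            have e5 := Finset.card_le_card hsub
            have e6 := Finset.card_le_univ T
            omega
          -- The |A| + 1 removed constraints move from m to the complement, leaving the budget
          -- against δ unchanged.
          have h2 := ih (T \ insert s A) (m - A.card - 1) (by
            rw [hc]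
            have : m - A.card - 1 + (Tᶜ.card + (A.card + 1)) = m + Tᶜ.card := by omega
            have h3 : ((m - A.card - 1 : ℕ) : ℝ) + ((Tᶜ.card + (A.card + 1) : ℕ) : ℝ) =
              (m : ℝ) + (Tᶜ.card : ℝ) := by exact_mod_cast this
            rw [h3]
            exact hm)
          have h3 : ({α : Fin n → F | A ⊆ T ∧ G (some s) A α}.ncard : ℝ) ≤
              2 ^ (2 * n * j) * x ^ (m - A.card - 1 - j) * q ^ n := by
            refine le_trans ?_ h2
            refine Nat.cast_le.2 (Set.ncard_le_ncard ?_)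
            intro α hα
            exact hα.2.2.2
          calc x ^ A.card * _ ≤ x ^ A.card * (2 ^ (2 * n * j) * x ^ (m - A.card - 1 - j) * q ^ n) :=
                mul_le_mul_of_nonneg_left h3 (by positivity)
            _ = 2 ^ (2 * n * j) * x ^ (A.card + (m - A.card - 1 - j)) * q ^ n := by
                rw [pow_add]; ring
            _ ≤ 2 ^ (2 * n * j) * x ^ (m - (j + 1)) * q ^ n := by
                have := pow_le_pow_of_le_one hx0 hx1
                  (show m - (j + 1) ≤ A.card + (m - A.card - 1 - j) by omega)
                gcongr
        · have : {α : Fin n → F | A ⊆ T ∧ G (some s) A α} = ∅ :=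
            Set.eq_empty_of_forall_notMem fun α hα => hA ⟨hα.1, hα.2.1, hα.2.2.1⟩
          rw [this, Set.ncard_empty, Nat.cast_zero, mul_zero]
          positivity
    have hidx : ((Finset.univ : Finset (Finset (Fin n) × Option (Fin n))).card : ℝ) ≤
        2 ^ (2 * n) := by
      rw [Finset.card_univ, Fintype.card_prod, Fintype.card_finset, Fintype.card_option,
        Fintype.card_fin]
      have : n + 1 ≤ 2 ^ n := Nat.lt_two_pow_self
      have h2 : 2 ^ n * (n + 1) ≤ 2 ^ (2 * n) := by
        rw [two_mul, pow_add]
        exact Nat.mul_le_mul_left _ this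
      exact_mod_cast h2
    calc _ ≤ ((⋃ p ∈ (Finset.univ : Finset (Finset (Fin n) × Option (Fin n))), Ev p).ncard : ℝ) := by
          exact_mod_cast Set.ncard_le_ncard hcover
      _ ≤ ∑ p, ((Ev p).ncard : ℝ) := by
          exact_mod_cast Finset.set_ncard_biUnion_le Finset.univ Ev
      _ ≤ (Finset.univ : Finset (Finset (Fin n) × Option (Fin n))).card •
          (2 ^ (2 * n * j) * x ^ (m - (j + 1)) * q ^ n) := Finset.sum_le_card_nsmul _ _ _ hEv
      _ ≤ 2 ^ (2 * n) * (2 ^ (2 * n * j) * x ^ (m - (j + 1)) * q ^ n) := by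
          rw [nsmul_eq_mul]
          exact mul_le_mul_of_nonneg_right hidx (by positivity)
      _ = _ := by rw [show 2 * n * (j + 1) = 2 * n + 2 * n * j by ring, pow_add]; ring

end RankInduction

/-! ### Level functions and the partition inequality. -/

section Levels

variable {E ι : Type*} [Field E] [Finite ι] [DecidableEq ι]

/-- Build a flag in U by repeatedly imposing the vanishing of one coordinate. The level of j records
the stage at which coordinate j starts to be nonzero. Differences between distinct levels occurring
on S then yield independent directions in the image. -/
theorem exists_level_function (r : ℕ) : ∀ U : Submodule E (ι → E), finrank E U = r →
    ∃ lev : ι → ℕ, (∀ j, lev j = 0 ↔ ∀ u ∈ U, u j = 0) ∧ (∀ j, lev j ≤ r) ∧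
      (∀ t, 0 < t → t ≤ r → ∃ j, lev j = t) ∧
      ∀ S : Finset ι, (S.image lev).card ≤ finrank E (U.map (diffOn E S)) + 1 := by
  classical
  induction r with
  | zero =>
    intro U hU
    have hU0 : U = ⊥ := Submodule.finrank_eq_zero.1 hU
    refine ⟨fun _ => 0, fun j => ⟨fun _ u hu => ?_, fun _ => rfl⟩, fun _ => le_rfl,
      fun t h0 h1 => by omega, fun S => ?_⟩
    · rw [hU0, Submodule.mem_bot] at hu
      rw [hu]; rfl
    · refine (Finset.card_le_card (t := {0}) ?_).trans (by simp)
      intro t ht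
      obtain ⟨j, -, rfl⟩ := Finset.mem_image.1 ht
      simp
  | succ r ih =>
    intro U hU
    have hne : U ≠ ⊥ := by
      rintro rfl
      simp at hU
    obtain ⟨v, hv, hv0⟩ := Submodule.exists_mem_ne_zero_of_ne_bot hne
    obtain ⟨c, hc⟩ := Function.ne_iff.1 hv0
    let p : (ι → E) →ₗ[E] E := LinearMap.proj c
    set U' : Submodule E (ι → E) := U ⊓ LinearMap.ker p with hU'
    have hU'r : finrank E U' = r := by
      have h1 := finrank_map_add_finrank_inf_ker p U
      have h2 : U.map p = ⊤ := by
        rcases eq_bot_or_eq_top (U.map p) with h | h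
        · exfalso
          have : p v ∈ U.map p := Submodule.mem_map_of_mem hv
          rw [h, Submodule.mem_bot] at this
          exact hc this
        · exact h
      rw [h2, finrank_top, finrank_self, hU, ← hU'] at h1
      omega
    obtain ⟨lev', h0', hle', hsurj', hcard'⟩ := ih U' hU'r
    have hvan : ∀ j, (∀ u ∈ U, u j = 0) → lev' j = 0 := fun j h =>
      (h0' j).2 fun u hu => h u hu.1
    set lev : ι → ℕ := fun j =>
      if ∀ u ∈ U, u j = 0 then 0 else if lev' j = 0 then r + 1 else lev' j with hlev
    have hlev0 : ∀ j, lev j = 0 ↔ ∀ u ∈ U, u j = 0 := by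
      intro j
      rw [hlev]
      dsimp only
      split_ifs with h1 h2
      · exact iff_of_true rfl h1
      · exact iff_of_false not_false h1
      · exact iff_of_false h2 h1
    refine ⟨lev, hlev0, ?_, ?_, ?_⟩
    · intro j
      have := hle' j
      rw [hlev]
      dsimp only
      split_ifs <;> omega
    · intro t ht0 ht
      rcases Nat.lt_or_ge r t with h | h
      · refine ⟨c, ?_⟩
        have h1 : ¬ ∀ u ∈ U, u c = 0 := fun h => hc (h v hv)
        have h2 : lev' c = 0 := (h0' c).2 fun u hu => hu.2
        rw [hlev]
        dsimp only
        rw [if_neg h1, if_pos h2]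
        omega
      · obtain ⟨j, hj⟩ := hsurj' t ht0 h
        refine ⟨j, ?_⟩
        have h1 : ¬ ∀ u ∈ U, u j = 0 := fun h => by
          have := hvan j h
          omega
        rw [hlev]
        dsimp only
        rw [if_neg h1, if_neg (by omega), hj]
    · intro S
      have hmono : U'.map (diffOn E S) ≤ U.map (diffOn E S) := Submodule.map_mono inf_le_left
      have hcS := hcard' S
      have hfr := Submodule.finrank_mono hmono
      -- The new level r + 1 adds to the count only if level 0 also survives on S. In that case the
      -- difference at (b, a) vanishes on U' but not on U, so the image grows.
      by_cases hb : ∃ b ∈ S, lev b ≠ 0 ∧ lev' b = 0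
      · by_cases ha : ∃ a ∈ S, lev a = 0
        · obtain ⟨b, hbS, hb0, hb'⟩ := hb
          obtain ⟨a, haS, ha0⟩ := ha
          have hlt : U'.map (diffOn E S) < U.map (diffOn E S) := by
            refine lt_of_le_of_ne hmono fun heq => ?_
            have : ¬ ∀ u ∈ U, u b = 0 := fun h => hb0 ((hlev0 b).2 h)
            push Not at this
            obtain ⟨u, hu, hub⟩ := this
            have hmem : diffOn E S u ∈ U'.map (diffOn E S) := by
              rw [heq]; exact Submodule.mem_map_of_mem hu
            obtain ⟨u', hu', he⟩ := hmem
            have h1 := congrFun he (b, a)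
            rw [diffOn_apply, diffOn_apply, if_pos ⟨hbS, haS⟩, if_pos ⟨hbS, haS⟩] at h1
            dsimp only at h1
            rw [(h0' b).1 hb' u' hu', (hlev0 a).1 ha0 u hu, (hlev0 a).1 ha0 u' hu'.1] at h1
            simp only [sub_zero] at h1
            exact hub h1.symm
          have h2 := Submodule.finrank_lt_finrank_of_lt hlt
          have h3 : S.image lev ⊆ insert (r + 1) (S.image lev') := by
            intro t ht
            obtain ⟨j, hj, rfl⟩ := Finset.mem_image.1 ht
            rw [Finset.mem_insert, Finset.mem_image]
            by_cases h1 : ∀ u ∈ U, u j = 0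
            · exact Or.inr ⟨j, hj, by rw [(hlev0 j).2 h1, hvan j h1]⟩
            · by_cases h2 : lev' j = 0
              · left; rw [hlev]; dsimp only; rw [if_neg h1, if_pos h2]
              · right; refine ⟨j, hj, ?_⟩; rw [hlev]; dsimp only; rw [if_neg h1, if_neg h2]
          have h4 := (Finset.card_le_card h3).trans (Finset.card_insert_le _ _)
          omega
        · push Not at ha
          have h3 : S.image lev ⊆ (S.image lev').image fun t => if t = 0 then r + 1 else t := by
            intro t ht
            obtain ⟨j, hj, rfl⟩ := Finset.mem_image.1 ht
            refine Finset.mem_image.2 ⟨lev' j, Finset.mem_image_of_mem _ hj, ?_⟩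
            have h1 : ¬ ∀ u ∈ U, u j = 0 := fun h => ha j hj ((hlev0 j).2 h)
            rw [hlev]
            dsimp only
            rw [if_neg h1]
          have h4 := (Finset.card_le_card h3).trans Finset.card_image_le
          omega
      · push Not at hb
        have h3 : S.image lev ⊆ S.image lev' := by
          intro t ht
          obtain ⟨j, hj, rfl⟩ := Finset.mem_image.1 ht
          refine Finset.mem_image.2 ⟨j, hj, ?_⟩
          by_cases h1 : ∀ u ∈ U, u j = 0
          · rw [(hlev0 j).2 h1, hvan j h1]
          · have h2 := hb j hj fun h => h1 ((hlev0 j).1 h)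
            rw [hlev]
            dsimp only
            rw [if_neg h1, if_neg h2]
        have h4 := Finset.card_le_card h3
        omega

theorem exists_level_function_on {J : Finset ι} {c : ι} (hc : c ∈ J) (U : Submodule E (ι → E))
    (hU : ∀ u ∈ U, u c = 0 ∧ ∀ j ∉ J, u j = 0) :
    ∃ lev : ι → ℕ, (J.image lev).card = finrank E U + 1 ∧
      ∀ S : Finset ι, (S.image lev).card ≤ finrank E (U.map (diffOn E S)) + 1 := by
  obtain ⟨lev, h0, hle, hsurj, hcard⟩ := exists_level_function (finrank E U) U rfl
  refine ⟨lev, ?_, hcard⟩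
  have : J.image lev = Finset.range (finrank E U + 1) := by
    ext t
    rw [Finset.mem_image, Finset.mem_range]
    constructor
    · rintro ⟨j, -, rfl⟩
      exact Nat.lt_succ_of_le (hle j)
    · intro ht
      rcases Nat.eq_zero_or_pos t with rfl | h
      · exact ⟨c, hc, (h0 c).2 fun u hu => (hU u hu).1⟩
      · obtain ⟨j, hj⟩ := hsurj t h (Nat.le_of_lt_succ ht)
        refine ⟨j, ?_, hj⟩
        by_contra hjJ
        have := (h0 j).2 fun u hu => (hU u hu).2 j hjJ
        omega
  rw [this, Finset.card_range]

theorem finrank_lt_card_of_vanishing {J : Finset ι} {c : ι} (hc : c ∈ J) (U : Submodule E (ι → E))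
    (hU : ∀ u ∈ U, u c = 0 ∧ ∀ j ∉ J, u j = 0) : finrank E U < J.card := by
  obtain ⟨lev, h1, -⟩ := exists_level_function_on hc U hU
  have := Finset.card_image_le (s := J) (f := lev)
  omega

omit [Finite ι] in
-- Split S ∩ J by level: each level class that occurs loses one, and the number of such classes is
-- the last image. Truncated subtraction makes empty classes contribute zero.
theorem card_inter_sub_one_le (lev : ι → ℕ) (S J : Finset ι) :
    (S ∩ J).card - 1 ≤ ∑ t ∈ J.image lev, ((S ∩ J.filter fun j => lev j = t).card - 1) +
      (((S ∩ J).image lev).card - 1) := by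
  rcases (S ∩ J).eq_empty_or_nonempty with h | h
  · simp [h]
  · have h1 : 1 ≤ ((S ∩ J).image lev).card := Finset.card_pos.2 (h.image _)
    have h2 := Finset.card_eq_sum_card_image lev (S ∩ J)
    have h3 : ∑ t ∈ (S ∩ J).image lev, ((S ∩ J).filter fun j => lev j = t).card ≤
        ∑ t ∈ (S ∩ J).image lev, ((((S ∩ J).filter fun j => lev j = t).card - 1) + 1) :=
      Finset.sum_le_sum fun t _ => by omega
    rw [Finset.sum_add_distrib, Finset.sum_const, smul_eq_mul, mul_one] at h3
    have h4 : ∑ t ∈ (S ∩ J).image lev, (((S ∩ J).filter fun j => lev j = t).card - 1) ≤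
        ∑ t ∈ J.image lev, ((S ∩ J.filter fun j => lev j = t).card - 1) := by
      refine (Finset.sum_le_sum_of_subset (Finset.image_subset_image
        Finset.inter_subset_right)).trans (le_of_eq (Finset.sum_congr rfl fun t _ => ?_))
      rw [Finset.inter_filter]
    omega

/-- The levels split J into dim U + 1 nonempty classes, all proper when U ≠ 0. Minimality bounds the
agreement inside the classes by N(|J| - dim U - 1), so at least N dim U must come from differences
between classes. -/
theorem mul_finrank_le_sum_finrank_diffOn {n : ℕ} {N : ℝ} (S : Fin n → Finset ι) {J : Finset ι}
    {c : ι} (hc : c ∈ J)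
    (hJ : N * ((J.card : ℝ) - 1) ≤ ∑ i, (((S i ∩ J).card - 1 : ℕ) : ℝ))
    (hmin : ∀ p ⊂ J, p.Nonempty →
      ∑ i, (((S i ∩ p).card - 1 : ℕ) : ℝ) ≤ N * ((p.card : ℝ) - 1))
    (U : Submodule E (ι → E)) (hU : ∀ u ∈ U, u c = 0 ∧ ∀ j ∉ J, u j = 0) :
    N * finrank E U ≤ ∑ i, (finrank E (U.map (diffOn E (S i ∩ J))) : ℝ) := by
  obtain ⟨lev, hJlev, hlev⟩ := exists_level_function_on hc U hU
  rcases Nat.eq_zero_or_pos (finrank E U) with h0 | hpos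
  · rw [h0, Nat.cast_zero, mul_zero]
    positivity
  have h1 : ∀ i, (((S i ∩ J).card - 1 : ℕ) : ℝ) ≤
      ∑ t ∈ J.image lev, (((S i ∩ J.filter fun j => lev j = t).card - 1 : ℕ) : ℝ) +
        (finrank E (U.map (diffOn E (S i ∩ J))) : ℝ) := by
    intro i
    have := card_inter_sub_one_le lev (S i) J
    have h2 := hlev (S i ∩ J)
    have h3 : (S i ∩ J).card - 1 ≤
        ∑ t ∈ J.image lev, ((S i ∩ J.filter fun j => lev j = t).card - 1) +
          finrank E (U.map (diffOn E (S i ∩ J))) := by omega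
    exact_mod_cast h3
  have h2 := hJ.trans (Finset.sum_le_sum fun i _ => h1 i)
  rw [Finset.sum_add_distrib, Finset.sum_comm] at h2
  have h3 : ∀ t ∈ J.image lev,
      ∑ i, (((S i ∩ J.filter fun j => lev j = t).card - 1 : ℕ) : ℝ) ≤
        N * (((J.filter fun j => lev j = t).card : ℝ) - 1) := by
    intro t ht
    obtain ⟨j, hj, hjt⟩ := Finset.mem_image.1 ht
    refine hmin _ ?_ ⟨j, Finset.mem_filter.2 ⟨hj, hjt⟩⟩
    refine lt_of_le_of_ne (Finset.filter_subset _ _) fun heq => ?_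
    have : J.image lev ⊆ {t} := by
      intro t' ht'
      obtain ⟨j', hj', rfl⟩ := Finset.mem_image.1 ht'
      rw [← heq] at hj'
      exact Finset.mem_singleton.2 (Finset.mem_filter.1 hj').2
    have := Finset.card_le_card this
    rw [hJlev, Finset.card_singleton] at this
    omega
  have h4 := Finset.sum_le_sum h3
  rw [← Finset.mul_sum, Finset.sum_sub_distrib, Finset.sum_const, hJlev, nsmul_eq_mul, mul_one] at h4
  have h5 : ∑ t ∈ J.image lev, ((J.filter fun j => lev j = t).card : ℝ) = (J.card : ℝ) := by
    exact_mod_cast (Finset.card_eq_sum_card_image lev J).symm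
  rw [h5, Nat.cast_add, Nat.cast_one] at h4
  nlinarith

end Levels

/-! ### Minimal agreement sets and the bound for one profile. -/

theorem exists_minimal_agreement {ι : Type*} [Fintype ι] [DecidableEq ι] {n : ℕ} {N : ℝ}
    (S : Fin n → Finset ι) (hι : 2 ≤ Fintype.card ι)
    (hS : N * ((Fintype.card ι : ℝ) - 1) ≤ ∑ i, (((S i).card - 1 : ℕ) : ℝ)) :
    ∃ J : Finset ι, 2 ≤ J.card ∧
      N * ((J.card : ℝ) - 1) ≤ ∑ i, (((S i ∩ J).card - 1 : ℕ) : ℝ) ∧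
      ∀ p ⊂ J, p.Nonempty → ∑ i, (((S i ∩ p).card - 1 : ℕ) : ℝ) ≤ N * ((p.card : ℝ) - 1) := by
  classical
  obtain ⟨J, hJ, hmin⟩ := Finset.exists_min_image
    (Finset.univ.filter fun J : Finset ι => 2 ≤ J.card ∧
      N * ((J.card : ℝ) - 1) ≤ ∑ i, (((S i ∩ J).card - 1 : ℕ) : ℝ)) Finset.card
    ⟨Finset.univ, by simpa using ⟨hι, hS⟩⟩
  rw [Finset.mem_filter] at hJ
  refine ⟨J, hJ.2.1, hJ.2.2, fun p hp hne => ?_⟩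
  have hlt := Finset.card_lt_card hp
  have hpos := Finset.card_pos.2 hne
  rcases Nat.lt_or_ge p.card 2 with h | h
  · have h1 : p.card = 1 := by omega
    have h2 : ∀ i, (S i ∩ p).card - 1 = 0 := fun i => by
      have := Finset.card_le_card (Finset.inter_subset_right (s₁ := S i) (s₂ := p))
      omega
    simp [h1, h2]
  · by_contra hcon
    push Not at hcon
    have := hmin p (Finset.mem_filter.2 ⟨Finset.mem_univ _, h, hcon.le⟩)
    omega

section Profiles

variable {F : Type*} [Field F] [Fintype F] {n L : ℕ}

theorem ncard_agreement_profile_le {k M : ℕ} (hL : 1 ≤ L) (hD : k * L ≤ Fintype.card F) {δ : ℝ}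
    (S : Fin n → Finset (Fin (L + 1)))
    (hS : ((k : ℝ) + δ) * L ≤ ∑ i, (((S i).card - 1 : ℕ) : ℝ)) (hM : (M : ℝ) ≤ δ) :
    ({α : Fin n → F | ∃ f : Fin (L + 1) → F[X], (∀ j, f j ∈ degreeLT F k) ∧
      Function.Injective f ∧ ∀ i, ∀ j ∈ S i, ∀ j' ∈ S i,
        (f j).eval (α i) = (f j').eval (α i)}.ncard : ℝ) ≤
      2 ^ (2 * n * L) * ((k * L : ℕ) / (Fintype.card F : ℝ)) ^ (M - L) *
        (Fintype.card F : ℝ) ^ n := by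
  classical
  obtain ⟨J, hJ2, hJ, hmin⟩ := exists_minimal_agreement (N := (k : ℝ) + δ) S
    (by simpa using hL) (by simpa using hS)
  obtain ⟨c, hc, c', hc', hcc'⟩ := Finset.one_lt_card.1 hJ2
  -- Pinning coordinate c to zero removes the constant vectors, which satisfy every constraint.
  set Z : Submodule F (Fin (L + 1) → F[X]) :=
    { carrier := {f | f c = 0 ∧ ∀ j ∉ J, f j = 0}
      add_mem' := fun {f g} hf hg => ⟨by simp [hf.1, hg.1], fun j hj => by
        simp [hf.2 j hj, hg.2 j hj]⟩
      zero_mem' := ⟨rfl, fun _ _ => rfl⟩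
      smul_mem' := fun a f hf => ⟨by simp [hf.1], fun j hj => by simp [hf.2 j hj]⟩ } with hZ
  set W₀ := polyVecLT F (Fin (L + 1)) k ⊓ Z with hW₀
  have hvan : ∀ u ∈ ratSpan W₀, u c = 0 ∧ ∀ j ∉ J, u j = 0 := by
    intro u hu
    induction hu using Submodule.span_induction with
    | mem u hu =>
      obtain ⟨f, hf, rfl⟩ := hu
      have hfZ : f c = 0 ∧ ∀ j ∉ J, f j = 0 := hf.2
      exact ⟨by simp [toRat, hfZ.1], fun j hj => by simp [toRat, hfZ.2 j hj]⟩
    | zero => exact ⟨rfl, fun _ _ => rfl⟩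
    | add u v _ _ hu hv =>
      exact ⟨by simp [hu.1, hv.1], fun j hj => by simp [hu.2 j hj, hv.2 j hj]⟩
    | smul a u _ hu => exact ⟨by simp [hu.1], fun j hj => by simp [hu.2 j hj]⟩
  have hd : finrank (RatFunc F) (ratSpan W₀) ≤ L := by
    have h1 := finrank_lt_card_of_vanishing hc (ratSpan W₀) hvan
    have h2 := Finset.card_le_univ J
    rw [Fintype.card_fin] at h2
    omega
  have hδ : ∀ V ≤ ratSpan W₀, ((k : ℝ) + δ) * finrank (RatFunc F) V ≤
      ∑ i, (finrank (RatFunc F) (V.map (diffOn (RatFunc F) (S i ∩ J))) : ℝ) := fun V hV =>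
    mul_finrank_le_sum_finrank_diffOn S hc hJ hmin V fun u hu => hvan u (hV hu)
  have hmain := ncard_solSpace_rank_le (inf_le_left : W₀ ≤ _) hd hD (fun i => S i ∩ J) hδ L
    Finset.univ M (by simpa using hM)
  refine le_trans (Nat.cast_le.2 (Set.ncard_le_ncard ?_)) hmain
  rintro α ⟨f, hfk, hfinj, hf⟩
  -- Subtracting f c preserves the agreements on J; injectivity of f keeps g nonzero at c'.
  set g : Fin (L + 1) → F[X] := fun j => if j ∈ J then f j - f c else 0 with hg
  have hgsol : g ∈ solSpace W₀ (fun i => S i ∩ J) α Finset.univ := by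
    refine mem_solSpace.2 ⟨⟨mem_polyVecLT.2 fun j => ?_, ?_, fun j hj => if_neg hj⟩,
      fun i _ => (evalDiff_eq_zero_iff _ _ _).2 fun j hj j' hj' => ?_⟩
    · rw [hg]
      dsimp only
      split_ifs
      · exact Submodule.sub_mem _ (hfk j) (hfk c)
      · exact Submodule.zero_mem _
    · simp [hg]
    · rw [Finset.mem_inter] at hj hj'
      simp only [hg, if_pos hj.2, if_pos hj'.2, eval_sub, hf i j hj.1 j' hj'.1]
  have hgne : g ≠ 0 := by
    intro h0
    have h1 := congrFun h0 c'
    simp only [hg, if_pos hc', Pi.zero_apply, sub_eq_zero] at h1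
    exact hcc' (hfinj h1).symm
  have hne : ratSpan (solSpace W₀ (fun i => S i ∩ J) α Finset.univ) ≠ ⊥ :=
    ratSpan_ne_bot fun hb => hgne (by rwa [hb, Submodule.mem_bot] at hgsol)
  refine ⟨hne, ?_⟩
  have : finrank (RatFunc F) (ratSpan (solSpace W₀ (fun i => S i ∩ J) α Finset.univ)) ≠ 0 :=
    fun h => hne (Submodule.finrank_eq_zero.1 h)
  change L + 1 ≤
    finrank (RatFunc F) (ratSpan (solSpace W₀ (fun i => S i ∩ J) α Finset.univ)) + L
  omega

end Profiles

/-! ### From a failure of list-decoding to an agreement profile. -/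

/-- Discarding an element of weight at least c keeps the average at most c; if there is none, any
subset of size m works. -/
theorem exists_subset_card_eq_sum_le {β : Type*} [DecidableEq β] (w : β → ℝ) (c : ℝ) (m : ℕ)
    (X : Finset β) : m ≤ X.card → ∑ x ∈ X, w x ≤ c * X.card →
    ∃ Y ⊆ X, Y.card = m ∧ ∑ x ∈ Y, w x ≤ c * m := by
  induction X using Finset.strongInduction with
  | H X ih =>
    intro hm hX
    by_cases h : ∃ a ∈ X, c ≤ w a
    · rcases hm.eq_or_lt with rfl | hlt
      · exact ⟨X, subset_rfl, rfl, hX⟩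
      · obtain ⟨a, ha, hca⟩ := h
        have hcard := Finset.card_erase_add_one ha
        obtain ⟨Y, hY, h1, h2⟩ := ih (X.erase a) (Finset.erase_ssubset ha) (by omega) (by
          have h3 := Finset.add_sum_erase X w ha
          have h4 : (X.card : ℝ) = (X.erase a).card + 1 := by exact_mod_cast hcard.symm
          rw [h4] at hX
          nlinarith)
        exact ⟨Y, hY.trans (Finset.erase_subset _ _), h1, h2⟩
    · push Not at h
      obtain ⟨Y, hY, h1⟩ := Finset.exists_subset_card_eq hm
      refine ⟨Y, hY, h1, ?_⟩
      have := Finset.sum_le_card_nsmul Y w c fun x hx => (h x (hY hx)).le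
      rwa [nsmul_eq_mul, h1, mul_comm] at this

theorem sum_card_agreement {F : Type*} [Field F] [DecidableEq F] {n m : ℕ}
    (x : Fin m → Fin n → F) (z : Fin n → F) :
    ∑ i, ((Finset.univ.filter fun j => x j i = z i).card : ℝ) =
      ∑ j, ((n : ℝ) - (hammingNorm (x j - z) : ℝ)) := by
  have h : ∀ j, (n : ℝ) - (hammingNorm (x j - z) : ℝ) =
      ((Finset.univ.filter fun i => x j i = z i).card : ℝ) := by
    intro j
    have h1 := Finset.card_filter_add_card_filter_not
      (s := (Finset.univ : Finset (Fin n))) (fun i => x j i = z i)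
    have h2 : hammingNorm (x j - z) = (Finset.univ.filter fun i => ¬ x j i = z i).card := by
      rw [hammingNorm]
      congr 1
      ext i
      simp [sub_eq_zero]
    rw [Finset.card_univ, Fintype.card_fin] at h1
    rw [h2, sub_eq_iff_eq_add]
    exact_mod_cast h1.symm
  simp_rw [h, Finset.card_filter, Nat.cast_sum]
  rw [Finset.sum_comm]

theorem exists_agreement_profile {F : Type*} [Field F] [DecidableEq F] {n k L : ℕ} {ρ : ℝ}
    {α : Fin n → F} (h : ¬ IsAvgListDecodable (rsCode α k) ρ L) :
    ∃ (S : Fin n → Finset (Fin (L + 1))) (f : Fin (L + 1) → F[X]),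
      (n : ℝ) * (L - ρ * (L + 1)) ≤ ∑ i, (((S i).card - 1 : ℕ) : ℝ) ∧
      (∀ j, f j ∈ degreeLT F k) ∧ Function.Injective f ∧
      ∀ i, ∀ j ∈ S i, ∀ j' ∈ S i, (f j).eval (α i) = (f j').eval (α i) := by
  rw [IsAvgListDecodable, not_not] at h
  obtain ⟨X, hXC, ⟨z, hz⟩, hcard⟩ := h
  have hX0 : (0 : ℝ) < X.card := by exact_mod_cast (Nat.zero_le L).trans_lt hcard
  rw [div_le_iff₀ hX0] at hz
  obtain ⟨Y, hYX, hYcard, hY⟩ := exists_subset_card_eq_sum_le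
    (fun x => (hammingNorm (x - z) : ℝ)) (ρ * n) (L + 1) X hcard hz
  let e : Fin (L + 1) ≃ Y := (Y.equivFinOfCardEq hYcard).symm
  have hf : ∀ j, ∃ f : F[X], f.degree < (k : WithBot ℕ) ∧
      ((e j : Fin n → F)) = fun i => f.eval (α i) := fun j => hXC (hYX (e j).2)
  choose f hfdeg hfe using hf
  refine ⟨fun i => Finset.univ.filter fun j => (e j : Fin n → F) i = z i, f, ?_,
    fun j => mem_degreeLT.2 (hfdeg j), fun j j' hjj' => ?_, fun i j hj j' hj' => ?_⟩
  · have h1 := sum_card_agreement (fun j => (e j : Fin n → F)) z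
    have h2 : ∑ j, (hammingNorm ((e j : Fin n → F) - z) : ℝ) ≤ ρ * n * (L + 1 : ℕ) := by
      refine le_trans (le_of_eq ?_) hY
      rw [← Finset.sum_coe_sort Y]
      exact e.sum_comp fun y : Y => (hammingNorm ((y : Fin n → F) - z) : ℝ)
    have h3 : ∑ i : Fin n, (((Finset.univ.filter fun j => (e j : Fin n → F) i = z i).card : ℝ) - 1) ≤
        ∑ i : Fin n, (((Finset.univ.filter fun j => (e j : Fin n → F) i = z i).card - 1 : ℕ) : ℝ) := by
      refine Finset.sum_le_sum fun i _ => ?_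
      rw [sub_le_iff_le_add]
      exact_mod_cast Nat.le_add_of_sub_le le_rfl
    refine le_trans ?_ h3
    rw [Finset.sum_sub_distrib, h1, Finset.sum_sub_distrib]
    simp only [Finset.sum_const, Finset.card_univ, Fintype.card_fin, nsmul_eq_mul, mul_one]
    push_cast at h2 ⊢
    linarith
  · have : (e j : Fin n → F) = e j' := by rw [hfe, hfe, hjj']
    exact e.injective (Subtype.ext this)
  · have h1 := (Finset.mem_filter.1 hj).2
    have h2 := (Finset.mem_filter.1 hj').2
    rw [hfe] at h1 h2
    exact h1.trans h2.symm

/-! ### Probabilities, numerical estimates and the union bound. -/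

theorem iidUniform_real_eq {F : Type*} [Field F] [Fintype F]
    [MeasurableSpace F] [MeasurableSingletonClass F] (n : ℕ) (B : Set (Fin n → F)) :
    (iidUniform F n).real B = (B.ncard : ℝ) / (Fintype.card F : ℝ) ^ n := by
  classical
  have hs : ∀ α : Fin n → F, (iidUniform F n).real {α} = ((Fintype.card F : ℝ) ^ n)⁻¹ := by
    intro α
    rw [iidUniform, measureReal_def, Measure.pi_singleton]
    simp [uniformOn_univ]
  have hfin : B.Finite := Set.toFinite B
  have : IsProbabilityMeasure (iidUniform F n) := by
    rw [iidUniform]; infer_instance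
  have h := sum_measureReal_singleton (μ := iidUniform F n) hfin.toFinset
  rw [hfin.coe_toFinset] at h
  rw [← h, Finset.sum_congr rfl fun α _ => hs α, Finset.sum_const, nsmul_eq_mul,
    ← Set.ncard_eq_toFinset_card B hfin, div_eq_mul_inv]

theorem two_pow_mul_pow_le {n L M : ℕ} (hL : 1 ≤ L) {ε η x : ℝ} (hε : 0 < ε) (hη : 0 ≤ η)
    (hεn : 2 * ((L : ℝ) + 1) * ((L : ℝ) + 2) ≤ ε * n) (hM : ε * n < M + 1) (hx0 : 0 ≤ x)
    (hx : x ≤ (2 : ℝ) ^ (-(2 * ((L : ℝ) + 1) * (((L : ℝ) + 1 + η) / ε)))) :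
    (2 : ℝ) ^ ((L + 1) * n) * (2 ^ (2 * n * L) * x ^ (M - L)) ≤ (2 : ℝ) ^ (-η * (n : ℝ)) := by
  have hL1 : (1 : ℝ) ≤ L := by exact_mod_cast hL
  have hLM : L ≤ M := by
    have : (L : ℝ) < (M : ℝ) + 1 := by nlinarith
    have : L < M + 1 := by exact_mod_cast this
    omega
  have h1 : x ^ (M - L) ≤ (2 : ℝ) ^ (-(((L : ℝ) + 1) * ((L : ℝ) + 1 + η) * n)) := by
    refine (pow_le_pow_left₀ hx0 hx _).trans ?_
    rw [← Real.rpow_natCast, ← Real.rpow_mul (by norm_num)]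
    refine Real.rpow_le_rpow_of_exponent_le (by norm_num) ?_
    rw [Nat.cast_sub hLM]
    -- Since M > εn - 1 and εn/2 ≥ (L+1)(L+2) ≥ L + 1, subtracting L costs at most half of εn.
    have h2 : ε * n / 2 ≤ (M : ℝ) - L := by nlinarith
    have h3 : ((L : ℝ) + 1) * ((L : ℝ) + 1 + η) * n =
        (2 * ((L : ℝ) + 1) * (((L : ℝ) + 1 + η) / ε)) * (ε * n / 2) := by
      field_simp
    rw [h3, neg_mul, neg_le_neg_iff]
    exact mul_le_mul_of_nonneg_left h2 (by positivity)
  calc (2 : ℝ) ^ ((L + 1) * n) * (2 ^ (2 * n * L) * x ^ (M - L))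
      ≤ (2 : ℝ) ^ ((L + 1) * n) * (2 ^ (2 * n * L) *
        (2 : ℝ) ^ (-(((L : ℝ) + 1) * ((L : ℝ) + 1 + η) * n))) := by gcongr
    _ = (2 : ℝ) ^ ((((L : ℝ) + 1) * n) + (2 * n * L +
        -(((L : ℝ) + 1) * ((L : ℝ) + 1 + η) * n))) := by
        rw [Real.rpow_add (by norm_num), Real.rpow_add (by norm_num)]
        have e1 : (2 : ℝ) ^ ((L + 1) * n) = (2 : ℝ) ^ (((L : ℝ) + 1) * n) := by
          rw [← Real.rpow_natCast]; push_cast; rfl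
        have e2 : (2 : ℝ) ^ (2 * n * L) = (2 : ℝ) ^ (2 * (n : ℝ) * L) := by
          rw [← Real.rpow_natCast]; push_cast; rfl
        rw [e1, e2]
    _ ≤ _ := by
        refine Real.rpow_le_rpow_of_exponent_le (by norm_num) ?_
        have hn : (0 : ℝ) ≤ n := Nat.cast_nonneg n
        -- The slack in the exponent, (L+1)(L+1+η) - (3L+1) - η, equals L(L-1) + Lη.
        have h4 : 0 ≤ (L : ℝ) * ((L : ℝ) - 1) * n :=
          mul_nonneg (mul_nonneg (by linarith) (by linarith)) hn
        have h5 : 0 ≤ (L : ℝ) * η * n := by positivity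
        nlinarith

theorem mul_div_card_le {k L : ℕ} (hL : 1 ≤ L) {ε q t : ℝ} (hε : 0 < ε) (hε1 : ε ≤ 1) (hq : 0 < q)
    (h : (2 : ℝ) ^ t * ((k : ℝ) * (4 * ((L : ℝ) + 1)) ^ (4 * (L + 1)) / ε) ≤ q) :
    ((k * L : ℕ) : ℝ) / q ≤ (2 : ℝ) ^ (-t) := by
  have hL1 : (1 : ℝ) ≤ L := by exact_mod_cast hL
  have h1 : (L : ℝ) ≤ (4 * ((L : ℝ) + 1)) ^ (4 * (L + 1)) := by
    have := le_self_pow₀ (a := 4 * ((L : ℝ) + 1)) (by linarith) (show 4 * (L + 1) ≠ 0 by omega)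
    linarith
  have h2 : ((k * L : ℕ) : ℝ) ≤ (k : ℝ) * (4 * ((L : ℝ) + 1)) ^ (4 * (L + 1)) / ε := by
    rw [le_div_iff₀ hε]
    push_cast
    calc (k : ℝ) * L * ε ≤ (k : ℝ) * L * 1 := by gcongr
      _ ≤ _ := by rw [mul_one]; gcongr
  have ht : (0 : ℝ) < 2 ^ t := Real.rpow_pos_of_pos (by norm_num) _
  rw [Real.rpow_neg (by norm_num), div_le_iff₀ hq, inv_mul_eq_div, le_div_iff₀ ht, mul_comm]
  exact (mul_le_mul_of_nonneg_left h2 ht.le).trans h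

/-- List-decodability of random Reed-Solomon codes. -/
theorem mainTheorem7 {F : Type*} [Field F] [Fintype F] [DecidableEq F]
    [MeasurableSpace F] [MeasurableSingletonClass F]
    (n k L : ℕ) (hL : 1 ≤ L) (ρ R ε η : ℝ) (hρ : ρ ∈ Set.Icc (0 : ℝ) 1) (hε : 0 < ε)
    (hεn : 2 * ((L : ℝ) + 1) * ((L : ℝ) + 2) ≤ ε * n)
    (hk : (k : ℝ) = R * n)
    (hR : R ≤ 1 - ρ * (1 + 1 / (L : ℝ)) - ε)
    (hq : (2 : ℝ) ^ (2 * ((L : ℝ) + 1) * (((L : ℝ) + 1 + η) / ε)) *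
        ((k : ℝ) * (4 * ((L : ℝ) + 1)) ^ (4 * (L + 1)) / ε) ≤ (Fintype.card F : ℝ)) :
    1 - (2 : ℝ) ^ (-η * (n : ℝ)) ≤
      (iidUniform F n).real {α : Fin n → F | IsAvgListDecodable (rsCode α k) ρ L} := by
  classical
  -- For negative η the claimed lower bound is at most 0.
  rcases lt_or_ge η 0 with hη | hη
  · have : (1 : ℝ) ≤ (2 : ℝ) ^ (-η * (n : ℝ)) :=
      Real.one_le_rpow (by norm_num) (mul_nonneg (by linarith) (Nat.cast_nonneg n))
    linarith [measureReal_nonneg (μ := iidUniform F n)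
      (s := {α : Fin n → F | IsAvgListDecodable (rsCode α k) ρ L})]
  have hL1 : (1 : ℝ) ≤ L := by exact_mod_cast hL
  have hn : (0 : ℝ) < n := by
    by_contra h
    have h0 : (n : ℝ) = 0 := le_antisymm (not_lt.1 h) (Nat.cast_nonneg n)
    rw [h0, mul_zero] at hεn
    nlinarith
  -- As k ≥ 0 and n > 0, the rate R is nonnegative, which caps ε.
  have hε1 : ε ≤ 1 := by
    have hR0 : 0 ≤ R := by
      by_contra h
      have h1 : (0 : ℝ) ≤ k := Nat.cast_nonneg k
      nlinarith
    have : 0 ≤ ρ * (1 + 1 / (L : ℝ)) := mul_nonneg hρ.1 (by positivity)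
    linarith
  have hcard : (0 : ℝ) < Fintype.card F := by exact_mod_cast Fintype.card_pos
  set x : ℝ := ((k * L : ℕ) : ℝ) / (Fintype.card F : ℝ) with hx
  have hx0 : 0 ≤ x := by positivity
  have hxle := mul_div_card_le hL hε hε1 hcard hq
  rw [← hx] at hxle
  have hD : k * L ≤ Fintype.card F := by
    have h1 : x ≤ 1 := hxle.trans (Real.rpow_le_one_of_one_le_of_nonpos (by norm_num)
      (neg_nonpos.2 (by positivity)))
    rw [hx, div_le_one hcard] at h1
    exact_mod_cast h1
  set M := ⌊ε * n⌋₊ with hM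
  have hMle : (M : ℝ) ≤ ε * n := Nat.floor_le (by positivity)
  have hMlt : ε * n < M + 1 := Nat.lt_floor_add_one _
  set B : Set (Fin n → F) := {α | ¬ IsAvgListDecodable (rsCode α k) ρ L} with hB
  let P : Finset (Fin n → Finset (Fin (L + 1))) := Finset.univ.filter fun S =>
    ((k : ℝ) + ε * n) * L ≤ ∑ i, (((S i).card - 1 : ℕ) : ℝ)
  let Ev : (Fin n → Finset (Fin (L + 1))) → Set (Fin n → F) := fun S =>
    {α | ∃ f : Fin (L + 1) → F[X], (∀ j, f j ∈ degreeLT F k) ∧ Function.Injective f ∧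
      ∀ i, ∀ j ∈ S i, ∀ j' ∈ S i, (f j).eval (α i) = (f j').eval (α i)}
  have hcover : B ⊆ ⋃ S ∈ P, Ev S := by
    intro α hα
    obtain ⟨S, f, hS, hf⟩ := exists_agreement_profile hα
    refine Set.mem_iUnion₂.2 ⟨S, Finset.mem_filter.2 ⟨Finset.mem_univ _, le_trans ?_ hS⟩, f, hf⟩
    have h1 : R * n * L ≤ (1 - ρ * (1 + 1 / (L : ℝ)) - ε) * n * L := by gcongr
    have h2 : (1 - ρ * (1 + 1 / (L : ℝ)) - ε) * n * L =
        n * (L - ρ * (L + 1)) - ε * n * L := by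
      field_simp
    rw [hk, add_mul]
    linarith
  have hBcard : (B.ncard : ℝ) ≤
      2 ^ ((L + 1) * n) * (2 ^ (2 * n * L) * x ^ (M - L)) * (Fintype.card F : ℝ) ^ n := by
    calc (B.ncard : ℝ) ≤ ((⋃ S ∈ P, Ev S).ncard : ℝ) := by
          exact_mod_cast Set.ncard_le_ncard hcover
      _ ≤ ∑ S ∈ P, ((Ev S).ncard : ℝ) := by exact_mod_cast Finset.set_ncard_biUnion_le P Ev
      _ ≤ P.card • (2 ^ (2 * n * L) * x ^ (M - L) * (Fintype.card F : ℝ) ^ n) :=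
          Finset.sum_le_card_nsmul _ _ _ fun S hS =>
            ncard_agreement_profile_le hL hD S (Finset.mem_filter.1 hS).2 hMle
      _ ≤ 2 ^ ((L + 1) * n) * (2 ^ (2 * n * L) * x ^ (M - L) * (Fintype.card F : ℝ) ^ n) := by
          rw [nsmul_eq_mul]
          refine mul_le_mul_of_nonneg_right ?_ (by positivity)
          have := Finset.card_le_univ P
          rw [Fintype.card_fun, Fintype.card_finset, Fintype.card_fin, Fintype.card_fin,
            ← pow_mul] at this
          exact_mod_cast this
      _ = _ := by ring
  have hBreal : (iidUniform F n).real B ≤ (2 : ℝ) ^ (-η * (n : ℝ)) := by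
    rw [iidUniform_real_eq, div_le_iff₀ (pow_pos hcard n)]
    exact hBcard.trans (mul_le_mul_of_nonneg_right
      (two_pow_mul_pow_le hL hε hη hεn hMlt hx0 hxle) (by positivity))
  have hprob : IsProbabilityMeasure (iidUniform F n) := by
    rw [iidUniform]; infer_instance
  have hcompl := probReal_compl_eq_one_sub (μ := iidUniform F n) (s := B)
    (Set.toFinite B).measurableSet
  have hBc : Bᶜ = {α : Fin n → F | IsAvgListDecodable (rsCode α k) ρ L} := by
    ext α
    simp [hB]
  rw [← hBc, hcompl]
  linarith
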